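/- Let $F_2=\langle\gamma_1,\gamma_2\rangle$ be the free group on two generators. For a linear algebraic group $G$ over $\mathbb C$ let $\mathbb C[X_G(F_2)]=\mathbb C[\mathrm{Hom}(F_2,G)]^{G}$ be the coordinate ring of the character variety $X_G(F_2)=\mathrm{Hom}(F_2,G)/\!/G$, where $\mathrm{Hom}(F_2,G)\cong G^2$ and $G$ acts by conjugation. Let $\phi:SL(2,\mathbb C)\times SL(2,\mathbb C)\to SO(4,\mathbb C)$ be the epimorphism with kernel $\{\pm(I,I)\}$ for which $\phi(A,B)$ is the matrix of $A\otimes B$ acting on $\mathbb C^2\otimes\mathbb C^2$ in the basis $$\tfrac1{\sqrt2}(e_1\otimes e_1+e_2\otimes e_2),\quad \tfrac{i}{\sqrt2}(e_1\otimes e_1-e_2\otimes e_2),\quad \tfrac{i}{\sqrt2}(e_1\otimes e_2+e_2\otimes e_1),\quad \tfrac1{\sqrt2}(e_1\otimes e_2-e_2\otimes e_1),$$ which is orthonormal for the symmetric bilinear form $(u_1\otimes u_2,v_1\otimes v_2)\mapsto\det(u_1,v_1)\det(u_2,v_2)$. For a pair $\rho=(\rho_1,\rho_2)$ of representations $F_2\to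 SL(2,\mathbb C)$ put $\tau_{i,j}(\rho)=\mathrm{tr}\,\rho_j(\gamma_i)$ and $\tau_{12,j}(\rho)=\mathrm{tr}\,\rho_j(\gamma_1\gamma_2)$ for $i,j\in\{1,2\}$. Let $P$ be the polynomial ring over $\mathbb C$ in the $17$ variables $a_{i,j,k}$, $b_{j,k}$ ($i,j,k\in\{1,2\}$, $j\le k$) and $c_{i,j,k}$ ($i,j,k\in\{1,2\}$), and put $a_{i,2,1}=a_{i,1,2}$, $b_{2,1}=b_{1,2}$. Let $I\subset P$ be the ideal generated by $$a_{i,j,k}a_{i,j',k'}-a_{i,j,j'}a_{i,k,k'},\quad b_{j,k}b_{j',k'}-b_{j,j'}b_{k,k'},\quad c_{i,j,k}c_{i',j',k'}-a_{1,i,i'}a_{2,j,j'}b_{k,k'},$$ $$a_{1,j,k}c_{i,j',k'}-a_{1,i,k}c_{j,j',k'},\quad a_{2,j,k}c_{i,j',k'}-a_{2,j',k}c_{i,j,k'},\quad b_{j,k}c_{i,j',k'}-b_{j,k'}c_{i,j',k},$$ with all indices ranging over $\{1,2\}$. Then there is a unique isomorphism of $\mathbb C$-algebras $P/I\to\mathbb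 C[X_{SO(4,\mathbb C)}(F_2)]$ sending the classes of the variables $a_{i,j,k}$, $b_{j,k}$, $c_{i,j,k}$ to functions whose values at $\phi\circ(\rho_1,\rho_2)$ are, for all $\rho_1,\rho_2:F_2\to SL(2,\mathbb C)$, $$\tau_{i,j}(\rho)\tau_{i,k}(\rho),\qquad \tau_{12,j}(\rho)\tau_{12,k}(\rho),\qquad \tau_{1,i}(\rho)\tau_{2,j}(\rho)\tau_{12,k}(\rho),$$ respectively. -/

import Mathlib

open scoped MatrixGroups Kronecker

noncomputable section

namespace SO4CharVar

/-! ### Coordinate rings of character varieties of free groups -/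

section CharacterRing

variable {G n : Type*} [Group G] [Fintype n] [DecidableEq n]

/-- For a group `G` embedded by `ι` as a Zariski-closed set of `n × n` complex matrices, the set
`Hom(F_N, G)` is identified with the algebraic set `G ^ N` of `N`-tuples of matrices through the
images of the free generators.  This is its coordinate ring: the algebra of the functions on
`Hom(F_N, G)` that are polynomials in the matrix entries of the images of the generators. -/
def homCoordRing (ι : G →* Matrix n n ℂ) (N : ℕ) : Subalgebra ℂ ((FreeGroup (Fin N) →* G) → ℂ) :=
  (MvPolynomial.aeval (R := ℂ) (fun (x : Fin N × n × n) (ρ : FreeGroup (Fin N) →* G) =>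
    ι (ρ (FreeGroup.of x.1)) x.2.1 x.2.2)).range

/-- The functions on `Hom(F_N, G)` that are invariant under conjugation by `G`. -/
def conjInvariant (G : Type*) [Group G] (N : ℕ) :
    Subalgebra ℂ ((FreeGroup (Fin N) →* G) → ℂ) where
  carrier := {f | ∀ (g : G) (ρ : FreeGroup (Fin N) →* G),
    f ((MulAut.conj g).toMonoidHom.comp ρ) = f ρ}
  mul_mem' hf hg h ρ := by
    simp only [Pi.mul_apply]
    rw [hf h ρ, hg h ρ]
  add_mem' hf hg h ρ := by
    simp only [Pi.add_apply]
    rw [hf h ρ, hg h ρ]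
  algebraMap_mem' _ _ _ := rfl

/-- The coordinate ring `ℂ[X_G(F_N)] = ℂ[Hom(F_N, G)] ^ G` of the categorical quotient
`X_G(F_N) = Hom(F_N, G) // G`. -/
def charCoordRing (ι : G →* Matrix n n ℂ) (N : ℕ) :
    Subalgebra ℂ ((FreeGroup (Fin N) →* G) → ℂ) :=
  homCoordRing ι N ⊓ conjInvariant G N

end CharacterRing

/-! ### The group `SO(4, ℂ)` and the epimorphism from `SL(2, ℂ) × SL(2, ℂ)` -/

/-- The complex special orthogonal group: `A * Aᵀ = 1` (plain transpose) and `det A = 1`. -/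
abbrev SO4 : Type := Matrix.specialOrthogonalGroup (Fin 4) ℂ

theorem mem_SO4_iff {A : Matrix (Fin 4) (Fin 4) ℂ} :
    A ∈ Matrix.specialOrthogonalGroup (Fin 4) ℂ ↔ A * A.transpose = 1 ∧ A.det = 1 := by
  rw [Matrix.mem_specialOrthogonalGroup_iff, Matrix.mem_orthogonalGroup_iff]

/-- The coordinate ring `ℂ[X_{SO(4, ℂ)}(F_2)]`. -/
abbrev charRingSO4 : Subalgebra ℂ ((FreeGroup (Fin 2) →* SO4) → ℂ) :=
  charCoordRing (Matrix.specialOrthogonalGroup (Fin 4) ℂ).subtype 2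

/-- The Gram matrix of `(u, v) ↦ det (u, v)` on `ℂ²`. -/
def detForm : Matrix (Fin 2) (Fin 2) ℂ := !![0, 1; -1, 0]

/-- The columns of this matrix are `√2` times the basis
`w₁ = (e₁ ⊗ e₁ + e₂ ⊗ e₂) / √2`, `w₂ = i (e₁ ⊗ e₁ - e₂ ⊗ e₂) / √2`,
`w₃ = i (e₁ ⊗ e₂ + e₂ ⊗ e₁) / √2`, `w₄ = (e₁ ⊗ e₂ - e₂ ⊗ e₁) / √2` of `ℂ² ⊗ ℂ²`, which is
orthonormal for the symmetric form
`(u₁ ⊗ u₂, v₁ ⊗ v₂) ↦ det (u₁, v₁) det (u₂, v₂)`. -/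
def frame : Matrix (Fin 2 × Fin 2) (Fin 4) ℂ := fun p =>
  ![![![1, Complex.I, 0, 0], ![0, 0, Complex.I, 1]],
    ![![0, 0, Complex.I, -1], ![1, -Complex.I, 0, 0]]] p.1 p.2

/-- The matrix of `A ⊗ B`, acting on `ℂ² ⊗ ℂ²`, in the orthonormal basis `w₁, …, w₄`: its
`(k, l)` entry is the value of the symmetric form on `w_k` and `(A ⊗ B) w_l`. -/
def spinMatrix (A B : Matrix (Fin 2) (Fin 2) ℂ) : Matrix (Fin 4) (Fin 4) ℂ :=
  (1 / 2 : ℂ) • (frame.transpose * (detForm ⊗ₖ detForm) * (A ⊗ₖ B) * frame)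

theorem frame_orthonormal :
    frame.transpose * (detForm ⊗ₖ detForm) * frame = (2 : ℂ) • 1 := by
  ext i j
  fin_cases i <;> fin_cases j <;>
    simp [frame, detForm, Matrix.mul_apply, Fintype.sum_prod_type, Fin.sum_univ_two] <;> norm_num

theorem frame_mul_transpose :
    frame * frame.transpose = (2 : ℂ) • (detForm ⊗ₖ detForm) := by
  ext ⟨i, i'⟩ ⟨j, j'⟩
  fin_cases i <;> fin_cases i' <;> fin_cases j <;> fin_cases j' <;>
    simp [frame, detForm, Matrix.mul_apply, Fin.sum_univ_four] <;> norm_num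

theorem detForm_mul_self : (detForm ⊗ₖ detForm) * (detForm ⊗ₖ detForm) = 1 := by
  rw [← Matrix.mul_kronecker_mul]
  ext ⟨i, i'⟩ ⟨j, j'⟩
  fin_cases i <;> fin_cases i' <;> fin_cases j <;> fin_cases j' <;>
    simp [detForm]

theorem spinMatrix_one : spinMatrix 1 1 = 1 := by
  rw [spinMatrix, Matrix.one_kronecker_one, Matrix.mul_one, frame_orthonormal, smul_smul]
  norm_num

theorem spinMatrix_mul (A B A' B' : Matrix (Fin 2) (Fin 2) ℂ) :
    spinMatrix (A * A') (B * B') = spinMatrix A B * spinMatrix A' B' := by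
  have h : frame.transpose * (detForm ⊗ₖ detForm) * (A ⊗ₖ B) * frame *
      (frame.transpose * (detForm ⊗ₖ detForm) * (A' ⊗ₖ B') * frame) =
      frame.transpose * (detForm ⊗ₖ detForm) * (A ⊗ₖ B) * (frame * frame.transpose) *
        (detForm ⊗ₖ detForm) * (A' ⊗ₖ B') * frame := by
    simp only [Matrix.mul_assoc]
  rw [spinMatrix, spinMatrix, spinMatrix, Matrix.smul_mul, Matrix.mul_smul, h, frame_mul_transpose,
    Matrix.mul_kronecker_mul]
  simp only [Matrix.mul_smul, Matrix.smul_mul, smul_smul]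
  rw [Matrix.mul_assoc _ (detForm ⊗ₖ detForm) (detForm ⊗ₖ detForm), detForm_mul_self,
    Matrix.mul_one, ← Matrix.mul_assoc]
  norm_num

theorem mul_detForm_mul_transpose (A : SL(2, ℂ)) :
    (A : Matrix (Fin 2) (Fin 2) ℂ) * detForm * (A : Matrix (Fin 2) (Fin 2) ℂ).transpose =
      detForm := by
  have h := A.det_coe
  rw [Matrix.det_fin_two] at h
  ext i j
  fin_cases i <;> fin_cases j <;>
    simp [detForm, Matrix.mul_apply, Fin.sum_univ_two] <;> grind

theorem spinMatrix_mem (A B : SL(2, ℂ)) :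
    spinMatrix A B ∈ Matrix.specialOrthogonalGroup (Fin 4) ℂ := by
  rw [mem_SO4_iff]
  have hJ : (detForm ⊗ₖ detForm).transpose = detForm ⊗ₖ detForm := by
    rw [← Matrix.kroneckerMap_transpose]
    ext ⟨i, i'⟩ ⟨j, j'⟩
    fin_cases i <;> fin_cases i' <;> fin_cases j <;> fin_cases j' <;> simp [detForm]
  constructor
  · have h : frame.transpose * (detForm ⊗ₖ detForm) * (A.1 ⊗ₖ B.1) * frame *
        (frame.transpose * (detForm ⊗ₖ detForm) * (A.1 ⊗ₖ B.1) * frame).transpose =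
        frame.transpose * (detForm ⊗ₖ detForm) * ((A.1 ⊗ₖ B.1) * (frame * frame.transpose) *
          (A.1.transpose ⊗ₖ B.1.transpose)) * ((detForm ⊗ₖ detForm) * frame) := by
      simp only [Matrix.transpose_mul, Matrix.transpose_transpose, hJ, Matrix.mul_assoc,
        Matrix.kroneckerMap_transpose]
    have h' : A.1 ⊗ₖ B.1 * (detForm ⊗ₖ detForm) * (A.1.transpose ⊗ₖ B.1.transpose) =
        detForm ⊗ₖ detForm := by
      rw [← Matrix.mul_kronecker_mul, ← Matrix.mul_kronecker_mul, mul_detForm_mul_transpose,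
        mul_detForm_mul_transpose]
    rw [spinMatrix, Matrix.transpose_smul, Matrix.smul_mul, Matrix.mul_smul, h,
      frame_mul_transpose, Matrix.mul_smul, Matrix.smul_mul, h', Matrix.mul_smul, Matrix.smul_mul,
      Matrix.mul_assoc frame.transpose, detForm_mul_self, Matrix.mul_one, ← Matrix.mul_assoc,
      frame_orthonormal, smul_smul, smul_smul, smul_smul]
    norm_num
  · have h1 : (1 / 2 : ℂ) • (frame.transpose * (detForm ⊗ₖ detForm)) * frame = 1 := by
      rw [Matrix.smul_mul, frame_orthonormal, smul_smul]
      norm_num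
    have h2 : frame * ((1 / 2 : ℂ) • (frame.transpose * (detForm ⊗ₖ detForm))) = 1 := by
      rw [Matrix.mul_smul, ← Matrix.mul_assoc, frame_mul_transpose, Matrix.smul_mul,
        detForm_mul_self, smul_smul]
      norm_num
    rw [spinMatrix, ← Matrix.smul_mul, ← Matrix.smul_mul, Matrix.det_conj_of_mul_eq_one h1 h2,
      Matrix.det_kronecker]
    simp

/-- The epimorphism `φ : SL(2, ℂ) × SL(2, ℂ) → SO(4, ℂ)` with kernel `{(I, I), (-I, -I)}`. -/
def phi : SL(2, ℂ) × SL(2, ℂ) →* SO4 where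
  toFun x := ⟨spinMatrix x.1 x.2, spinMatrix_mem x.1 x.2⟩
  map_one' := Subtype.ext spinMatrix_one
  map_mul' x y := Subtype.ext (spinMatrix_mul x.1 x.2 y.1 y.2)

/-! ### The 17 generators and their relations

The indices `1, 2` are written `0, 1 : Fin 2`. -/

/-- The names of the `17` generators: `a i s(j, k)` is `a_{i,j,k}`, `b s(j, k)` is `b_{j,k}` and
`c i j k` is `c_{i,j,k}`.  Unordered pairs encode `a_{i,2,1} = a_{i,1,2}` and
`b_{2,1} = b_{1,2}`. -/
inductive Gen : Type
  | a (i : Fin 2) (jk : Sym2 (Fin 2))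
  | b (jk : Sym2 (Fin 2))
  | c (i j k : Fin 2)

/-- `trGen i j ρ` is `τ_{i,j}(ρ) = tr ρ_j(γ_i)` for a pair `ρ = (ρ_1, ρ_2)` of
representations of `F_2 = ⟨γ_1, γ_2⟩` into `SL(2, ℂ)`. -/
def trGen (i j : Fin 2) (ρ : Fin 2 → FreeGroup (Fin 2) →* SL(2, ℂ)) : ℂ :=
  (ρ j (FreeGroup.of i) : Matrix (Fin 2) (Fin 2) ℂ).trace

/-- `trProd j ρ` is `τ_{12,j}(ρ) = tr ρ_j(γ_1 γ_2)`. -/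
def trProd (j : Fin 2) (ρ : Fin 2 → FreeGroup (Fin 2) →* SL(2, ℂ)) : ℂ :=
  (ρ j (FreeGroup.of 0 * FreeGroup.of 1) : Matrix (Fin 2) (Fin 2) ℂ).trace

/-- The functions `a_{i,j,k} = τ_{i,j} τ_{i,k}`, `b_{j,k} = τ_{12,j} τ_{12,k}` and
`c_{i,j,k} = τ_{1,i} τ_{2,j} τ_{12,k}` on the pairs of representations into `SL(2, ℂ)`. -/
def Gen.value (ρ : Fin 2 → FreeGroup (Fin 2) →* SL(2, ℂ)) : Gen → ℂ
  | .a i jk => (jk.map fun j => trGen i j ρ).mul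
  | .b jk => (jk.map fun j => trProd j ρ).mul
  | .c i j k => trGen 0 i ρ * trGen 1 j ρ * trProd k ρ

/-- The variable `a_{i,j,k}`. -/
def a (i j k : Fin 2) : MvPolynomial Gen ℂ := MvPolynomial.X (Gen.a i s(j, k))

/-- The variable `b_{j,k}`. -/
def b (j k : Fin 2) : MvPolynomial Gen ℂ := MvPolynomial.X (Gen.b s(j, k))

/-- The variable `c_{i,j,k}`. -/
def c (i j k : Fin 2) : MvPolynomial Gen ℂ := MvPolynomial.X (Gen.c i j k)

/-- The binomial relations; all indices range over the two values independently. -/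
inductive Rel : MvPolynomial Gen ℂ → Prop
  | aa (i j k j' k' : Fin 2) : Rel (a i j k * a i j' k' - a i j j' * a i k k')
  | bb (j k j' k' : Fin 2) : Rel (b j k * b j' k' - b j j' * b k k')
  | cc (i j k i' j' k' : Fin 2) : Rel (c i j k * c i' j' k' - a 0 i i' * a 1 j j' * b k k')
  | ac₁ (i j k j' k' : Fin 2) : Rel (a 0 j k * c i j' k' - a 0 i k * c j j' k')
  | ac₂ (i j k j' k' : Fin 2) : Rel (a 1 j k * c i j' k' - a 1 j' k * c i j k')
  | bc (i j k j' k' : Fin 2) : Rel (b j k * c i j' k' - b j k' * c i j' k)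

/-- The ideal generated by the relations. -/
def relIdeal : Ideal (MvPolynomial Gen ℂ) := Ideal.span {p | Rel p}

end SO4CharVar

end

namespace SO4CharVar

/-! ### Surjectivity of the epimorphism onto `SO(4, ℂ)` -/

/-! Since `phi` is surjective and F₂ is free, every representation into SO(4) lifts to a pair of
representations into SL(2). Functions on Hom(F₂, SO(4)) can therefore be compared after pullback
along `toSO4`, where everything is expressed through six traces.

An invariant regular function pulls back to a function invariant under conjugating each member of
the pair separately, and such a function is a polynomial in the six traces (`exists_eval_traces`).
Indeed, if t is an eigenvalue of A⁻¹B with eigenvector v, the basis v, Av brings (A, B) to a form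
depending only on the traces and t. Common eigenvectors are handled by an orbit closure argument.
Averaging over the choices of t removes the roots.

The pullback is also unchanged when both lifts are multiplied by one character F₂ → {±1}. Averaging
over the four characters leaves the monomials whose degrees in the three blocks of traces (γ₁, γ₂,
γ₁γ₂) have the same parity, and these are products of the generators (`exists_toTraces_eval`).
Conversely, each generator is a polynomial in products of two matrix entries at the same γₘ, which
come from SO(4) (`value_mem_pulledBack`).

The six traces take all values in ℂ⁶ (`traces_surjective`), so the relations are exactly the kernel
of a monomial map. The binomials generate it because they reduce every monomial in the generators to
a normal form depending only on its exponent in the traces (`ker_toTraces`). -/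

theorem spinMatrix_apply (A B : Matrix (Fin 2) (Fin 2) ℂ) (k l : Fin 4) :
    spinMatrix A B k l = 1 / 2 * ∑ p : Fin 2 × Fin 2, ∑ q : Fin 2 × Fin 2,
      (frame.transpose * (detForm ⊗ₖ detForm)) k p * (A p.1 q.1 * B p.2 q.2) * frame q l := by
  rw [spinMatrix, Matrix.smul_apply, Matrix.mul_assoc, Matrix.mul_apply, smul_eq_mul]
  simp only [Matrix.mul_apply (M := A ⊗ₖ B), Finset.mul_sum, Matrix.kroneckerMap_apply, mul_assoc]

/-- A unit vector is the first column of the image of some `(A, 1)`. -/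
theorem exists_spinMatrix_col_zero (v : Fin 4 → ℂ)
    (hv : v 0 ^ 2 + v 1 ^ 2 + v 2 ^ 2 + v 3 ^ 2 = 1) :
    ∃ A B : SL(2, ℂ), ∀ k, spinMatrix A B k 0 = v k := by
  have hI := Complex.I_sq
  -- Viewing ℂ² ⊗ ℂ² as 2 × 2 matrices, A ⊗ B acts by X ↦ A X Bᵀ and √2 w₁ is the identity. With B =
  -- 1, A must be the matrix of √2 ∑ vₖ wₖ, whose determinant is the sum of the squares.
  refine ⟨⟨!![v 0 + Complex.I * v 1, Complex.I * v 2 + v 3;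
    Complex.I * v 2 - v 3, v 0 - Complex.I * v 1], ?_⟩, 1, ?_⟩
  · rw [Matrix.det_fin_two_of]; grind
  · intro k
    fin_cases k <;>
      simp [spinMatrix_apply, frame, detForm, Matrix.mul_apply, Fintype.sum_prod_type,
        Fin.sum_univ_two, Matrix.one_apply] <;> grind

/-- A unit vector orthogonal to the first basis vector is the second column of an image that fixes
the first basis vector. -/
theorem exists_spinMatrix_col_one (v : Fin 4 → ℂ) (h0 : v 0 = 0)
    (hv : v 1 ^ 2 + v 2 ^ 2 + v 3 ^ 2 = 1) :
    ∃ A B : SL(2, ℂ), (∀ k, spinMatrix A B k 0 = if k = 0 then 1 else 0) ∧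
      ∀ k, spinMatrix A B k 1 = v k := by
  have hI := Complex.I_sq
  -- The stabiliser of w₁ consists of the pairs with B = (A⁻¹)ᵀ, acting by X ↦ A X A⁻¹. The
  -- equations say that A conjugates i·diag(1, -1) to the traceless matrix Y of v.
  obtain ⟨p, q, r, s, hdet, h1, h2, h3⟩ : ∃ p q r s : ℂ, p * s - q * r = 1 ∧
      p * s + q * r = v 1 ∧ -2 * (p * q) * Complex.I = Complex.I * v 2 + v 3 ∧
      2 * (r * s) * Complex.I = Complex.I * v 2 - v 3 := by
    suffices h : ∃ p q r s : ℂ, p * s - q * r ≠ 0 ∧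
        p * s + q * r = v 1 * (p * s - q * r) ∧
        -2 * (p * q) * Complex.I = (Complex.I * v 2 + v 3) * (p * s - q * r) ∧
        2 * (r * s) * Complex.I = (Complex.I * v 2 - v 3) * (p * s - q * r) by
      obtain ⟨p, q, r, s, h, h1, h2, h3⟩ := h
      obtain ⟨z, hz⟩ := IsAlgClosed.exists_pow_nat_eq (p * s - q * r)⁻¹ (n := 2) (by norm_num)
      have hz' : z ^ 2 * (p * s - q * r) = 1 := by rw [hz, inv_mul_cancel₀ h]
      exact ⟨z * p, z * q, z * r, z * s, by linear_combination hz',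
        by linear_combination z ^ 2 * h1 + v 1 * hz',
        by linear_combination z ^ 2 * h2 + (Complex.I * v 2 + v 3) * hz',
        by linear_combination z ^ 2 * h3 + (Complex.I * v 2 - v 3) * hz'⟩
    -- The columns of A are eigenvectors of Y for i and -i. They are columns of Y + i and Y - i,
    -- chosen nonzero according to the case.
    by_cases h : v 1 = -1
    · refine ⟨Complex.I * v 2 + v 3, Complex.I * v 1 - Complex.I, -(Complex.I * v 1) + Complex.I,
        Complex.I * v 2 - v 3, ?_, ?_, ?_, ?_⟩ <;> grind
    · refine ⟨Complex.I * v 1 + Complex.I, Complex.I * v 2 + v 3, Complex.I * v 2 - v 3,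
        -(Complex.I * v 1) - Complex.I, ?_, ?_, ?_, ?_⟩ <;> grind
  refine ⟨⟨!![p, q; r, s], by rw [Matrix.det_fin_two_of, hdet]⟩,
    ⟨!![s, -r; -q, p], by rw [Matrix.det_fin_two_of]; linear_combination hdet⟩, ?_, ?_⟩ <;>
  · intro k
    fin_cases k <;>
      simp [spinMatrix_apply, frame, detForm, Matrix.mul_apply, Fintype.sum_prod_type,
        Fin.sum_univ_two] <;> grind

/-- A rotation that fixes the first two basis vectors is in the image of the diagonal torus. -/
theorem exists_spinMatrix_eq {M : Matrix (Fin 4) (Fin 4) ℂ}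
    (hM : M ∈ Matrix.specialOrthogonalGroup (Fin 4) ℂ)
    (h0 : ∀ k, M k 0 = if k = 0 then 1 else 0) (h1 : ∀ k, M k 1 = if k = 1 then 1 else 0) :
    ∃ A B : SL(2, ℂ), spinMatrix A B = M := by
  have hI := Complex.I_sq
  obtain ⟨hO, hdet⟩ := mem_SO4_iff.1 hM
  have hO' : M.transpose * M = 1 := mul_eq_one_comm.1 hO
  have hr0 : ∀ k, M 0 k = if k = 0 then 1 else 0 := fun k => by
    have := congrFun (congrFun hO' 0) k
    simpa [Matrix.mul_apply, h0, Matrix.one_apply, eq_comm] using this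
  have hr1 : ∀ k, M 1 k = if k = 1 then 1 else 0 := fun k => by
    have := congrFun (congrFun hO' 1) k
    simpa [Matrix.mul_apply, h1, Matrix.one_apply, eq_comm] using this
  have hd : M 2 2 * M 3 3 - M 2 3 * M 3 2 = 1 := by
    rw [← hdet, Matrix.det_succ_row_zero, Fin.sum_univ_four]
    simp [Matrix.det_fin_three, hr0, hr1]
  have e22 : M 2 2 ^ 2 + M 3 2 ^ 2 = 1 := by
    have := congrFun (congrFun hO' 2) 2
    simp [Matrix.mul_apply, Fin.sum_univ_four, hr0, hr1] at this
    linear_combination this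
  have e23 : M 2 2 * M 2 3 + M 3 2 * M 3 3 = 0 := by
    have := congrFun (congrFun hO' 2) 3
    simpa [Matrix.mul_apply, Fin.sum_univ_four, hr0, hr1] using this
  have e33 : M 3 3 = M 2 2 := by grind
  have e32 : M 2 3 = - M 3 2 := by grind
  -- diag(u, u⁻¹) ⊗ diag(u⁻¹, u) scales e₁ ⊗ e₂ by u² and e₂ ⊗ e₁ by u⁻². These are the eigenvalues
  -- of the remaining 2 × 2 rotation.
  obtain ⟨u, hu⟩ := IsAlgClosed.exists_pow_nat_eq (M 2 2 - Complex.I * M 3 2) (n := 2)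
    (by norm_num)
  obtain ⟨w, hw⟩ : ∃ w, u * w = 1 := ⟨u * (M 2 2 + Complex.I * M 3 2), by grind⟩
  have hw2 : w ^ 2 = M 2 2 + Complex.I * M 3 2 := by grind
  refine ⟨⟨!![u, 0; 0, w], by rw [Matrix.det_fin_two_of]; linear_combination hw⟩,
    ⟨!![w, 0; 0, u], by rw [Matrix.det_fin_two_of]; linear_combination hw⟩, ?_⟩
  ext k l
  fin_cases k <;> fin_cases l <;>
    simp [spinMatrix_apply, frame, detForm, Matrix.mul_apply, Fintype.sum_prod_type,
        Fin.sum_univ_two, h0, h1, hr0, hr1] <;> grind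

theorem SO4.inv_mul_apply_of_col_eq (g M : SO4) (l : Fin 4)
    (h : ∀ k, g.1 k l = M.1 k l) (k : Fin 4) :
    (g⁻¹ * M).1 k l = if k = l then 1 else 0 := by
  have h1 : (g⁻¹ * M).1 k l = (g⁻¹ * g).1 k l := by
    simp only [Submonoid.coe_mul, Matrix.mul_apply, h]
  rw [h1, inv_mul_cancel, Submonoid.coe_one, Matrix.one_apply]

theorem SO4.sum_col_mul_col (M : SO4) (k l : Fin 4) :
    M.1 0 k * M.1 0 l + M.1 1 k * M.1 1 l + M.1 2 k * M.1 2 l + M.1 3 k * M.1 3 l =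
      if k = l then 1 else 0 := by
  have h : M.1.transpose * M.1 = 1 := mul_eq_one_comm.1 (mem_SO4_iff.1 M.2).1
  have := congrFun (congrFun h k) l
  simpa [Matrix.mul_apply, Fin.sum_univ_four, Matrix.one_apply] using this

theorem phi_surjective : Function.Surjective phi := by
  intro M
  obtain ⟨A, B, hAB⟩ := exists_spinMatrix_col_zero (fun k => M.1 k 0) (by
    simpa [← sq] using M.sum_col_mul_col 0 0)
  have hM₁ := SO4.inv_mul_apply_of_col_eq (phi (A, B)) M 0 hAB
  set M₁ := (phi (A, B))⁻¹ * M with hM₁_def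
  have h0 : M₁.1 0 1 = 0 := by simpa [hM₁] using M₁.sum_col_mul_col 0 1
  obtain ⟨C, D, h, hCD⟩ := exists_spinMatrix_col_one (fun k => M₁.1 k 1) h0 (by
    simpa [← sq, h0] using M₁.sum_col_mul_col 1 1)
  have hM₂ := SO4.inv_mul_apply_of_col_eq (phi (C, D)) M₁ 0 fun k => (h k).trans (hM₁ k).symm
  have hM₂' := SO4.inv_mul_apply_of_col_eq (phi (C, D)) M₁ 1 hCD
  obtain ⟨P, Q, hPQ⟩ := exists_spinMatrix_eq ((phi (C, D))⁻¹ * M₁).2 hM₂ hM₂'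
  have hPQ' : phi (P, Q) = (phi (C, D))⁻¹ * M₁ := Subtype.ext hPQ
  refine ⟨(A, B) * ((C, D) * (P, Q)), ?_⟩
  rw [map_mul, map_mul, hPQ', hM₁_def, mul_inv_cancel_left, mul_inv_cancel_left]

/-! ### Invariant functions on pairs of matrices -/

section

open Matrix

/-- Invariance under simultaneous conjugation of the values on pairs of matrices in `SL(2, ℂ)`. -/
def PairInvariant (F : Matrix (Fin 2) (Fin 2) ℂ → Matrix (Fin 2) (Fin 2) ℂ → ℂ) : Prop :=
  ∀ P A B A' B' : Matrix (Fin 2) (Fin 2) ℂ, P.det = 1 → A.det = 1 → B.det = 1 →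
    A * P = P * A' → B * P = P * B' → F A B = F A' B'

theorem exists_det_eq_one_col {v : Fin 2 → ℂ} (hv : v ≠ 0) :
    ∃ P : Matrix (Fin 2) (Fin 2) ℂ, P.det = 1 ∧ ∀ k, P k 0 = v k := by
  by_cases h : v 0 = 0
  · have h1 : v 1 ≠ 0 := fun h1 => hv (by ext k; fin_cases k <;> assumption)
    refine ⟨!![v 0, -(v 1)⁻¹; v 1, 0], ?_, ?_⟩
    · rw [det_fin_two_of]; field_simp; ring
    · intro k; fin_cases k <;> simp
  · refine ⟨!![v 0, 0; v 1, (v 0)⁻¹], ?_, ?_⟩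
    · rw [det_fin_two_of]; field_simp; ring
    · intro k; fin_cases k <;> simp

/-- Conjugation by diag(w, w⁻¹) rescales both off-diagonal entries by the same arbitrary nonzero
factor, so the diagonal pair lies in the closure of the orbit and continuity gives the equality. -/
theorem PairInvariant.upper {F : Matrix (Fin 2) (Fin 2) ℂ → Matrix (Fin 2) (Fin 2) ℂ → ℂ}
    (hF : PairInvariant F) (hc : Continuous (Function.uncurry F)) {a b : ℂ} (ha : a ≠ 0)
    (hb : b ≠ 0) (r s : ℂ) :
    F !![a, r; 0, a⁻¹] !![b, s; 0, b⁻¹] = F !![a, 0; 0, a⁻¹] !![b, 0; 0, b⁻¹] := by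
  have h : (fun z : ℂ => F !![a, z * r; 0, a⁻¹] !![b, z * s; 0, b⁻¹]) =
      fun _ => F !![a, r; 0, a⁻¹] !![b, s; 0, b⁻¹] := by
    refine Continuous.ext_on (dense_compl_singleton (0 : ℂ)) ?_ continuous_const ?_
    · have : Continuous fun z : ℂ => ((!![a, z * r; 0, a⁻¹], !![b, z * s; 0, b⁻¹]) :
          Matrix (Fin 2) (Fin 2) ℂ × Matrix (Fin 2) (Fin 2) ℂ) := by
        refine Continuous.prodMk ?_ ?_ <;>
        · refine continuous_pi fun i => continuous_pi fun j => ?_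
          fin_cases i <;> fin_cases j <;> simp <;> fun_prop
      exact hc.comp this
    · intro z hz
      obtain ⟨w, rfl⟩ := IsAlgClosed.exists_pow_nat_eq z (n := 2) (by norm_num)
      have hw : w ≠ 0 := by rintro rfl; simp at hz
      refine hF !![w, 0; 0, w⁻¹] _ _ _ _ ?_ ?_ ?_ ?_ ?_
      · rw [det_fin_two_of]; field_simp; ring
      · rw [det_fin_two_of]; field_simp; ring
      · rw [det_fin_two_of]; field_simp; ring
      · ext i j; fin_cases i <;> fin_cases j <;> simp [Matrix.mul_apply] <;> field_simp
      · ext i j; fin_cases i <;> fin_cases j <;> simp [Matrix.mul_apply] <;> field_simp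
  simpa using (congrFun h 0).symm

/-- Completing a common eigenvector to a unimodular basis makes both matrices upper triangular,
which reduces to `PairInvariant.upper`. -/
theorem PairInvariant.reducible {F : Matrix (Fin 2) (Fin 2) ℂ → Matrix (Fin 2) (Fin 2) ℂ → ℂ}
    (hF : PairInvariant F) (hc : Continuous (Function.uncurry F))
    {A B : Matrix (Fin 2) (Fin 2) ℂ} (hA : A.det = 1) (hB : B.det = 1) {v : Fin 2 → ℂ}
    (hv : v ≠ 0) {a b : ℂ} (ha : A *ᵥ v = a • v) (hb : B *ᵥ v = b • v) :
    a ≠ 0 ∧ b ≠ 0 ∧ A.trace = a + a⁻¹ ∧ B.trace = b + b⁻¹ ∧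
      F A B = F !![a, 0; 0, a⁻¹] !![b, 0; 0, b⁻¹] := by
  obtain ⟨P, hP, hPv⟩ := exists_det_eq_one_col hv
  have key : ∀ (C : Matrix (Fin 2) (Fin 2) ℂ) (e : ℂ), C.det = 1 → C *ᵥ v = e • v →
      e ≠ 0 ∧ C.trace = e + e⁻¹ ∧ ∃ r, C * P = P * !![e, r; 0, e⁻¹] := by
    intro C e hC hCv
    have hP' := hP
    have hC' := hC
    rw [det_fin_two] at hP' hC'
    have e0 := congrFun hCv 0
    have e1 := congrFun hCv 1
    simp [Matrix.mulVec, dotProduct, ← hPv] at e0 e1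
    have he : e ≠ 0 := by
      rintro rfl
      grind
    have htr : C.trace = e + e⁻¹ := by
      rw [trace_fin_two]
      field_simp
      grind
    rw [trace_fin_two] at htr
    -- The witness is the upper right entry of P⁻¹ C P, with P⁻¹ written as the adjugate.
    refine ⟨he, by rw [trace_fin_two, htr],
      P 1 1 * (C 0 0 * P 0 1 + C 0 1 * P 1 1) -
        P 0 1 * (C 1 0 * P 0 1 + C 1 1 * P 1 1), ?_⟩
    have hi : e⁻¹ = C 0 0 + C 1 1 - e := by rw [htr]; ring
    rw [hi]
    ext i j
    fin_cases i <;> fin_cases j <;> simp [Matrix.mul_apply] <;> grind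
  obtain ⟨ha0, hat, r, hr⟩ := key A a hA ha
  obtain ⟨hb0, hbt, s, hs⟩ := key B b hB hb
  exact ⟨ha0, hb0, hat, hbt, (hF P A B _ _ hP hA hB hr hs).trans (hF.upper hc ha0 hb0 r s)⟩

/-- An invariant continuous function on pairs is determined by its values on a section. -/
theorem PairInvariant.eq_normalForm {F : Matrix (Fin 2) (Fin 2) ℂ → Matrix (Fin 2) (Fin 2) ℂ → ℂ}
    (hF : PairInvariant F) (hc : Continuous (Function.uncurry F))
    {A B : Matrix (Fin 2) (Fin 2) ℂ} (hA : A.det = 1) (hB : B.det = 1) {w t : ℂ}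
    (hw : w = A.trace * B.trace - (A * B).trace) (ht : t ^ 2 = w * t - 1) :
    F A B = F !![0, -1; 1, A.trace] !![0, t - w; t, B.trace] := by
  have hA' := hA
  have hB' := hB
  rw [det_fin_two] at hA' hB'
  -- Here w = tr(A⁻¹B), so det(B - tA) = t² - wt + 1 = 0.
  obtain ⟨v, hv, hBv⟩ : ∃ v, v ≠ 0 ∧ (B - t • A) *ᵥ v = 0 := by
    rw [exists_mulVec_eq_zero_iff, det_fin_two]
    simp only [trace_fin_two, Matrix.mul_apply, Fin.sum_univ_two] at hw
    simp
    subst hw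
    grind
  rw [Matrix.sub_mulVec, sub_eq_zero, Matrix.smul_mulVec] at hBv
  have e0 := congrFun hBv 0
  have e1 := congrFun hBv 1
  simp [Matrix.mulVec, dotProduct] at e0 e1
  have hw' : w = A 0 0 * B 1 1 + A 1 1 * B 0 0 - A 0 1 * B 1 0 - A 1 0 * B 0 1 := by
    simp only [trace_fin_two, Matrix.mul_apply, Fin.sum_univ_two] at hw
    rw [hw]; ring
  -- The expression is det(v, Av): it vanishes exactly when v is an eigenvector of A, and then of B
  -- too since Bv = tAv.
  by_cases h : v 0 * (A 1 0 * v 0 + A 1 1 * v 1) - v 1 * (A 0 0 * v 0 + A 0 1 * v 1) = 0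
  · obtain ⟨a, ha⟩ : ∃ a : ℂ, A *ᵥ v = a • v := by
      by_cases h0 : v 0 = 0
      · have h1 : v 1 ≠ 0 := fun h1 => hv (by ext k; fin_cases k <;> assumption)
        refine ⟨A 1 1, ?_⟩
        ext k; fin_cases k <;> simp [Matrix.mulVec, dotProduct] <;> grind
      · refine ⟨(A 0 0 * v 0 + A 0 1 * v 1) / v 0, ?_⟩
        ext k; fin_cases k <;> simp [Matrix.mulVec, dotProduct] <;> field_simp <;> grind
    have hb : B *ᵥ v = (t * a) • v := by rw [hBv, ha, smul_smul]
    obtain ⟨ha0, hb0, hAt, hBt, e⟩ := hF.reducible hc hA hB hv ha hb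
    have htw : t - w = -t⁻¹ := by
      have : t ≠ 0 := left_ne_zero_of_mul hb0
      field_simp
      grind
    have ht0 : t ≠ 0 := left_ne_zero_of_mul hb0
    rw [e, hAt, hBt, htw]
    -- The target pair is also reducible, with this common eigenvector, but its eigenvalues are the
    -- inverses; the Weyl element below swaps the diagonal entries back.
    have hu : (![1, -a⁻¹] : Fin 2 → ℂ) ≠ 0 := fun h => by simpa using congrFun h 0
    obtain ⟨-, -, -, -, e'⟩ := hF.reducible hc (A := !![0, -1; 1, a + a⁻¹])
      (B := !![0, -t⁻¹; t, t * a + (t * a)⁻¹]) (a := a⁻¹) (b := (t * a)⁻¹)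
      (by rw [det_fin_two_of]; ring)
      (by rw [det_fin_two_of]; field_simp; ring) hu
      (by ext k; fin_cases k <;> simp [Matrix.mulVec, dotProduct] <;> field_simp <;> ring)
      (by ext k; fin_cases k <;> simp [Matrix.mulVec, dotProduct] <;> field_simp <;> ring)
    rw [e', inv_inv, inv_inv]
    refine hF !![0, -1; 1, 0] _ _ _ _ ?_ ?_ ?_ ?_ ?_
    · simp [det_fin_two_of]
    · rw [det_fin_two_of]; field_simp; ring
    · rw [det_fin_two_of]; field_simp; ring
    · simp
    · simp
  · obtain ⟨z, hz⟩ := IsAlgClosed.exists_pow_nat_eq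
      (v 0 * (A 1 0 * v 0 + A 1 1 * v 1) - v 1 * (A 0 0 * v 0 + A 0 1 * v 1))⁻¹ (n := 2)
      (by norm_num)
    have hz' := inv_mul_cancel₀ h
    rw [← hz] at hz'
    -- The conjugating matrix has columns v and Av, scaled by z to determinant one.
    refine hF (z • !![v 0, A 0 0 * v 0 + A 0 1 * v 1; v 1, A 1 0 * v 0 + A 1 1 * v 1])
      _ _ _ _ ?_ hA hB ?_ ?_
    · rw [Matrix.det_smul, Fintype.card_fin, det_fin_two_of]
      linear_combination hz'
    · rw [Matrix.mul_smul, Matrix.smul_mul]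
      congr 1
      rw [trace_fin_two]
      ext i j; fin_cases i <;> fin_cases j <;> simp [Matrix.mul_apply] <;> grind
    · rw [Matrix.mul_smul, Matrix.smul_mul]
      congr 1
      rw [trace_fin_two]
      ext i j; fin_cases i <;> fin_cases j <;> simp [Matrix.mul_apply]
      · linear_combination e0
      · linear_combination A 1 1 * e0 - A 0 1 * e1 + t * v 0 * hA' + v 0 * hw'
      · linear_combination e1
      · linear_combination A 0 0 * e1 - A 1 0 * e0 + t * v 1 * hA' + v 1 * hw'

end

section

open MvPolynomial

/-! ### The toric ideal -/

/-! ### Rewriting rules inside one block of traces -/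

section Block

variable {R : Type*} [CommRing R]

/-- The normal form of a monomial of bidegree `(p, q)`, `p + q` even, in the `u j k`. -/
def evenForm (u : Fin 2 → Fin 2 → R) (p q : ℕ) : R :=
  u 0 0 ^ (p / 2) * u 1 1 ^ (q / 2) * if p % 2 = 0 then 1 else u 0 1

/-- The normal form of the even part of a monomial of bidegree `(p, q)`, `p + q` odd. -/
def oddForm (u : Fin 2 → Fin 2 → R) (p q : ℕ) : R :=
  u 0 0 ^ (p / 2) * u 1 1 ^ (q / 2)

/-- The index left over in bidegree `(p, q)`, `p + q` odd. -/
def oddIndex (p : ℕ) : Fin 2 := if p % 2 = 0 then 1 else 0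

theorem exists_parity (p : ℕ) : ∃ r, p = 2 * r ∨ p = 2 * r + 1 := ⟨p / 2, by omega⟩

/-- The exponent vector of the `j`-th variable. -/
def δ (i j : Fin 2) : ℕ := if i = j then 1 else 0

/-- Here `u j k` plays the role of xⱼxₖ. The relation u₀₁² = u₀₀u₁₁ is needed only when p and q are
both odd. -/
theorem mul_evenForm {u : Fin 2 → Fin 2 → R} (hs : ∀ j k, u j k = u k j)
    (hu : ∀ j k j' k', u j k * u j' k' = u j j' * u k k') {p q : ℕ} (h : Even (p + q))
    (j k : Fin 2) :
    u j k * evenForm u p q = evenForm u (p + δ 0 j + δ 0 k) (q + δ 1 j + δ 1 k) := by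
  obtain ⟨r, rfl | rfl⟩ := exists_parity p <;> obtain ⟨s, rfl | rfl⟩ := exists_parity q <;>
    try (exfalso; revert h; simp [parity_simps]; done)
  · fin_cases j <;> fin_cases k <;>
      simp [evenForm, δ, add_assoc, Nat.add_mod, Nat.mul_add_div, pow_succ, hs 1 0] <;> ring
  · have := hu 0 1 0 1
    fin_cases j <;> fin_cases k <;>
      simp [evenForm, δ, add_assoc, Nat.add_mod, Nat.mul_add_div, pow_succ, hs 1 0] <;> grind

/-- An odd monomial leaves one variable over, carried by an index of `c`; `hc` trades that index
against one of `u` until it has the prescribed parity. -/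
theorem mul_oddForm {u : Fin 2 → Fin 2 → R} (hs : ∀ j k, u j k = u k j) {c : Fin 2 → R}
    (hc : ∀ i j k, u j k * c i = u i k * c j) {p q : ℕ} (h : Odd (p + q)) (j k : Fin 2) :
    u j k * (oddForm u p q * c (oddIndex p)) =
      oddForm u (p + δ 0 j + δ 0 k) (q + δ 1 j + δ 1 k) * c (oddIndex (p + δ 0 j + δ 0 k)) := by
  have h1 := hc 0 1 0
  have h2 := hc 0 1 1
  obtain ⟨r, rfl | rfl⟩ := exists_parity p <;> obtain ⟨s, rfl | rfl⟩ := exists_parity q <;>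
    try (exfalso; revert h; simp [parity_simps]; done)
  all_goals
    fin_cases j <;> fin_cases k <;>
      simp [oddForm, oddIndex, δ, add_assoc, Nat.add_mod, Nat.mul_add_div, pow_succ, hs 1 0] <;>
      grind

theorem mul_evenForm_eq_oddForm {u : Fin 2 → Fin 2 → R} (hs : ∀ j k, u j k = u k j)
    {c : Fin 2 → R} (hc : ∀ i j k, u j k * c i = u i k * c j) {p q : ℕ} (h : Even (p + q))
    (j : Fin 2) :
    c j * evenForm u p q = oddForm u (p + δ 0 j) (q + δ 1 j) * c (oddIndex (p + δ 0 j)) := by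
  have h1 := hc 0 1 0
  have h2 := hc 0 1 1
  obtain ⟨r, rfl | rfl⟩ := exists_parity p <;> obtain ⟨s, rfl | rfl⟩ := exists_parity q <;>
    try (exfalso; revert h; simp [parity_simps]; done)
  all_goals
    fin_cases j <;>
      simp [oddForm, evenForm, oddIndex, δ, add_assoc, Nat.add_mod, Nat.mul_add_div, pow_succ] <;>
      grind

theorem mul_oddForm_eq_evenForm {u : Fin 2 → Fin 2 → R} (hs : ∀ j k, u j k = u k j)
    {p q : ℕ} (h : Odd (p + q)) (j : Fin 2) :
    u j (oddIndex p) * oddForm u p q = evenForm u (p + δ 0 j) (q + δ 1 j) := by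
  obtain ⟨r, rfl | rfl⟩ := exists_parity p <;> obtain ⟨s, rfl | rfl⟩ := exists_parity q <;>
    try (exfalso; revert h; simp [parity_simps]; done)
  all_goals
    fin_cases j <;>
      simp [oddForm, evenForm, oddIndex, δ, add_assoc, Nat.add_mod, Nat.mul_add_div, pow_succ,
        hs 1 0] <;>
      ring

end Block

/-- The value of a generator when the six traces take the values `τ`: the block `0`, `1`, `2` of
`τ` holds the traces of `γ₁`, `γ₂`, `γ₁γ₂`. -/
def genVal {R : Type*} [CommRing R] (τ : Fin 3 × Fin 2 → R) : Gen → R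
  | .a i jk => (jk.map fun j => τ (i.castSucc, j)).mul
  | .b jk => (jk.map fun j => τ (2, j)).mul
  | .c i j k => τ (0, i) * τ (1, j) * τ (2, k)

/-- The exponent of a generator as a monomial in the six traces. -/
noncomputable def genDeg : Gen → (Fin 3 × Fin 2 →₀ ℕ)
  | .a i jk => (jk.map fun j => Finsupp.single (i.castSucc, j) 1).add
  | .b jk => (jk.map fun j => Finsupp.single (2, j) 1).add
  | .c i j k => Finsupp.single (0, i) 1 + Finsupp.single (1, j) 1 + Finsupp.single (2, k) 1

theorem genDeg_a_apply (i j k : Fin 2) (i' : Fin 3) (l : Fin 2) :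
    genDeg (.a i s(j, k)) (i', l) = if i' = i.castSucc then δ l j + δ l k else 0 := by
  simp only [genDeg, Sym2.map_mk, Sym2.add_mk, Finsupp.add_apply, Finsupp.single_apply,
    Prod.mk.injEq, δ]
  grind

theorem genDeg_b_apply (j k : Fin 2) (i' : Fin 3) (l : Fin 2) :
    genDeg (.b s(j, k)) (i', l) = if i' = 2 then δ l j + δ l k else 0 := by
  simp only [genDeg, Sym2.map_mk, Sym2.add_mk, Finsupp.add_apply, Finsupp.single_apply,
    Prod.mk.injEq, δ]
  grind

theorem genDeg_c_apply (i j k : Fin 2) (i' : Fin 3) (l : Fin 2) :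
    genDeg (.c i j k) (i', l) = δ l (![i, j, k] i') := by
  simp only [genDeg, Finsupp.add_apply, Finsupp.single_apply, Prod.mk.injEq, δ]
  fin_cases i' <;> simp [eq_comm]

theorem genVal_X (x : Gen) :
    genVal (X : _ → MvPolynomial (Fin 3 × Fin 2) ℂ) x = monomial (genDeg x) 1 := by
  cases x with
  | a i jk => induction jk with | _ j k => simp [genVal, genDeg, X, monomial_mul]
  | b jk => induction jk with | _ j k => simp [genVal, genDeg, X, monomial_mul]
  | c i j k => simp [genVal, genDeg, X, monomial_mul]

theorem map_genVal {R S : Type*} [CommRing R] [CommRing S] (f : R →+* S)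
    (τ : Fin 3 × Fin 2 → R) (x : Gen) : f (genVal τ x) = genVal (f ∘ τ) x := by
  cases x with
  | a i jk => induction jk with | _ j k => simp [genVal]
  | b jk => induction jk with | _ j k => simp [genVal]
  | c i j k => simp [genVal]

/-- Exponents of the monomials that are invariant under the sign changes. -/
def IsInvExp (e : Fin 3 × Fin 2 →₀ ℕ) : Prop :=
  (∀ i, Even (e (i, 0) + e (i, 1))) ∨ ∀ i, Odd (e (i, 0) + e (i, 1))

/-! ### Normal forms of monomials across the three blocks -/

section NormalForm

variable {R : Type*} [CommRing R]

/-- The quadratic generators of the three blocks. -/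
def quad (g : Gen → R) : Fin 3 → Fin 2 → Fin 2 → R :=
  ![fun j k => g (.a 0 s(j, k)), fun j k => g (.a 1 s(j, k)), fun j k => g (.b s(j, k))]

/-- The normal form of a monomial of exponent `e` in the generators. -/
def normalForm (g : Gen → R) (e : Fin 3 × Fin 2 →₀ ℕ) : R :=
  if Even (e (0, 0) + e (0, 1)) then
    evenForm (quad g 0) (e (0, 0)) (e (0, 1)) * evenForm (quad g 1) (e (1, 0)) (e (1, 1)) *
      evenForm (quad g 2) (e (2, 0)) (e (2, 1))
  else
    oddForm (quad g 0) (e (0, 0)) (e (0, 1)) * oddForm (quad g 1) (e (1, 0)) (e (1, 1)) *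
      oddForm (quad g 2) (e (2, 0)) (e (2, 1)) *
      g (.c (oddIndex (e (0, 0))) (oddIndex (e (1, 0))) (oddIndex (e (2, 0))))

theorem quad_symm {R : Type*} (g : Gen → R) (i : Fin 3) (j k : Fin 2) :
    quad g i j k = quad g i k j := by
  fin_cases i <;> simp [quad, Sym2.eq_swap]

theorem even_of_isInvExp {e : Fin 3 × Fin 2 →₀ ℕ} (he : IsInvExp e)
    (h : Even (e (0, 0) + e (0, 1))) (i : Fin 3) : Even (e (i, 0) + e (i, 1)) :=
  he.elim (fun h => h i) fun h' => absurd h (Nat.not_even_iff_odd.2 (h' 0))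

theorem odd_of_isInvExp {e : Fin 3 × Fin 2 →₀ ℕ} (he : IsInvExp e)
    (h : ¬ Even (e (0, 0) + e (0, 1))) (i : Fin 3) : Odd (e (i, 0) + e (i, 1)) :=
  he.elim (fun h' => absurd (h' 0) h) fun h' => h' i

/-- The normal form is multiplicative under multiplication by a generator. -/
theorem mul_normalForm [Algebra ℂ R] {g : Gen → R} (hg : ∀ p, Rel p → aeval g p = 0)
    {e : Fin 3 × Fin 2 →₀ ℕ} (he : IsInvExp e) (x : Gen) :
    IsInvExp (e + genDeg x) ∧ g x * normalForm g e = normalForm g (e + genDeg x) := by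
  have hu : ∀ i j k j' k', quad g i j k * quad g i j' k' = quad g i j j' * quad g i k k' := by
    intro i j k j' k'
    fin_cases i
    · have h := hg _ (Rel.aa 0 j k j' k'); simp [a, sub_eq_zero] at h; exact h
    · have h := hg _ (Rel.aa 1 j k j' k'); simp [a, sub_eq_zero] at h; exact h
    · have h := hg _ (Rel.bb j k j' k'); simp [b, sub_eq_zero] at h; exact h
  have hcc : ∀ i j k i' j' k', g (.c i j k) * g (.c i' j' k') =
      quad g 0 i i' * quad g 1 j j' * quad g 2 k k' := fun i j k i' j' k' => by
    have h := hg _ (Rel.cc i j k i' j' k'); simp [a, b, c, sub_eq_zero] at h; exact h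
  have h0 : ∀ j' k' i j k, quad g 0 j k * g (.c i j' k') = quad g 0 i k * g (.c j j' k') :=
    fun j' k' i j k => by
      have h := hg _ (Rel.ac₁ i j k j' k'); simp [a, c, sub_eq_zero] at h; exact h
  have h1 : ∀ i' k' i j k, quad g 1 j k * g (.c i' i k') = quad g 1 i k * g (.c i' j k') :=
    fun i' k' i j k => by
      have h := hg _ (Rel.ac₂ i' j k i k'); simp [a, c, sub_eq_zero] at h; exact h
  have h2 : ∀ i' j' i j k, quad g 2 j k * g (.c i' j' i) = quad g 2 i k * g (.c i' j' j) :=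
    fun i' j' i j k => by
      rw [quad_symm g 2 j, quad_symm g 2 i]
      have h := hg _ (Rel.bc i' k j j' i); simp [b, c, sub_eq_zero] at h; exact h
  cases x with
  | a i jk =>
    induction jk with | _ j k
    refine ⟨?_, ?_⟩
    · refine he.imp (fun h i' => ?_) fun h i' => ?_ <;>
      · have := h i'
        simp only [Finsupp.add_apply, genDeg_a_apply]
        split_ifs <;> fin_cases j <;> fin_cases k <;> simp [δ] <;> grind
    · by_cases h : Even (e (0, 0) + e (0, 1))
      · have hE := even_of_isInvExp he h
        fin_cases i
        · have h' : Even (e (0, 0) + (δ 0 j + δ 0 k) + (e (0, 1) + (δ 1 j + δ 1 k))) := by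
            fin_cases j <;> fin_cases k <;> simp [δ] <;> grind
          have := mul_evenForm (quad_symm g 0) (hu 0) (hE 0) j k
          simp only [add_assoc] at this
          simp [normalForm, genDeg_a_apply, h, h', ← this]
          simp [quad]
          ring
        · have := mul_evenForm (quad_symm g 1) (hu 1) (hE 1) j k
          simp only [add_assoc] at this
          simp [normalForm, genDeg_a_apply, h, ← this]
          simp [quad]
          ring
      · have hO := odd_of_isInvExp he h
        fin_cases i
        · have h' : ¬ Even (e (0, 0) + (δ 0 j + δ 0 k) + (e (0, 1) + (δ 1 j + δ 1 k))) := by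
            fin_cases j <;> fin_cases k <;> simp [δ] <;> grind
          have := mul_oddForm (quad_symm g 0)
            (h0 (oddIndex (e (1, 0))) (oddIndex (e (2, 0)))) (hO 0) j k
          simp only [add_assoc] at this
          simp [normalForm, genDeg_a_apply, h, h']
          simp [quad] at this ⊢
          linear_combination (oddForm (fun j k => g (.a 1 s(j, k))) (e (1, 0)) (e (1, 1)) *
            oddForm (fun j k => g (.b s(j, k))) (e (2, 0)) (e (2, 1))) * this
        · have := mul_oddForm (quad_symm g 1)
            (h1 (oddIndex (e (0, 0))) (oddIndex (e (2, 0)))) (hO 1) j k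
          simp only [add_assoc] at this
          simp [normalForm, genDeg_a_apply, h]
          simp [quad] at this ⊢
          linear_combination (oddForm (fun j k => g (.a 0 s(j, k))) (e (0, 0)) (e (0, 1)) *
            oddForm (fun j k => g (.b s(j, k))) (e (2, 0)) (e (2, 1))) * this
  | b jk =>
    induction jk with | _ j k
    refine ⟨?_, ?_⟩
    · refine he.imp (fun h i' => ?_) fun h i' => ?_ <;>
      · have := h i'
        simp only [Finsupp.add_apply, genDeg_b_apply]
        split_ifs <;> fin_cases j <;> fin_cases k <;> simp [δ] <;> grind
    · by_cases h : Even (e (0, 0) + e (0, 1))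
      · have hE := even_of_isInvExp he h
        have := mul_evenForm (quad_symm g 2) (hu 2) (hE 2) j k
        simp only [add_assoc] at this
        simp [normalForm, genDeg_b_apply, h, ← this]
        simp [quad]
        ring
      · have hO := odd_of_isInvExp he h
        have := mul_oddForm (quad_symm g 2)
          (h2 (oddIndex (e (0, 0))) (oddIndex (e (1, 0)))) (hO 2) j k
        simp only [add_assoc] at this
        simp [normalForm, genDeg_b_apply, h]
        simp [quad] at this ⊢
        linear_combination (oddForm (fun j k => g (.a 0 s(j, k))) (e (0, 0)) (e (0, 1)) *
          oddForm (fun j k => g (.a 1 s(j, k))) (e (1, 0)) (e (1, 1))) * this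
  | c i j k =>
    refine ⟨?_, ?_⟩
    · rcases he with h | h
      · refine Or.inr fun i' => ?_
        have := h i'
        simp only [Finsupp.add_apply, genDeg_c_apply]
        generalize (![i, j, k] i') = l
        fin_cases l <;> simp [δ] <;> grind
      · refine Or.inl fun i' => ?_
        have := h i'
        simp only [Finsupp.add_apply, genDeg_c_apply]
        generalize (![i, j, k] i') = l
        fin_cases l <;> simp [δ] <;> grind
    · by_cases h : Even (e (0, 0) + e (0, 1))
      · have hE := even_of_isInvExp he h
        have h' : ¬ Even (e (0, 0) + δ 0 i + (e (0, 1) + δ 1 i)) := by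
          fin_cases i <;> simp [δ] <;> grind
        -- The indices of the cubic generator are normalised one block at a time, so the later rules
        -- are applied with the earlier indices already replaced.
        have e0 := mul_evenForm_eq_oddForm (quad_symm g 0) (h0 j k) (hE 0) i
        have e1 := mul_evenForm_eq_oddForm (quad_symm g 1)
          (h1 (oddIndex (e (0, 0) + δ 0 i)) k) (hE 1) j
        have e2 := mul_evenForm_eq_oddForm (quad_symm g 2)
          (h2 (oddIndex (e (0, 0) + δ 0 i)) (oddIndex (e (1, 0) + δ 0 j))) (hE 2) k
        simp [normalForm, genDeg_c_apply, h, h']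
        linear_combination
          evenForm (quad g 1) (e (1, 0)) (e (1, 1)) *
            evenForm (quad g 2) (e (2, 0)) (e (2, 1)) * e0 +
          oddForm (quad g 0) (e (0, 0) + δ 0 i) (e (0, 1) + δ 1 i) *
            evenForm (quad g 2) (e (2, 0)) (e (2, 1)) * e1 +
          oddForm (quad g 0) (e (0, 0) + δ 0 i) (e (0, 1) + δ 1 i) *
            oddForm (quad g 1) (e (1, 0) + δ 0 j) (e (1, 1) + δ 1 j) * e2
      · have hO := odd_of_isInvExp he h
        have h' : Even (e (0, 0) + δ 0 i + (e (0, 1) + δ 1 i)) := by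
          fin_cases i <;> simp [δ] <;> grind
        have e0 := mul_oddForm_eq_evenForm (quad_symm g 0) (hO 0) i
        have e1 := mul_oddForm_eq_evenForm (quad_symm g 1) (hO 1) j
        have e2 := mul_oddForm_eq_evenForm (quad_symm g 2) (hO 2) k
        -- The product of two cubic generators splits into one quadratic generator per block, each
        -- absorbed by the odd part of its block.
        have e3 := hcc i j k (oddIndex (e (0, 0))) (oddIndex (e (1, 0))) (oddIndex (e (2, 0)))
        simp [normalForm, genDeg_c_apply, h, h']
        rw [← e0, ← e1, ← e2]
        linear_combination oddForm (quad g 0) (e (0, 0)) (e (0, 1)) *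
          oddForm (quad g 1) (e (1, 0)) (e (1, 1)) *
          oddForm (quad g 2) (e (2, 0)) (e (2, 1)) * e3

theorem map_normalForm {S : Type*} [CommRing S] (f : R →+* S) (g : Gen → R)
    (e : Fin 3 × Fin 2 →₀ ℕ) : f (normalForm g e) = normalForm (f ∘ g) e := by
  simp only [normalForm, evenForm, oddForm, quad]
  split_ifs <;> simp

/-- This shows that every sign-invariant monomial in the traces is a product of generators. -/
theorem normalForm_genVal (τ : Fin 3 × Fin 2 → R) {e : Fin 3 × Fin 2 →₀ ℕ} (he : IsInvExp e) :
    normalForm (genVal τ) e = ∏ i, τ i ^ e i := by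
  have hev : ∀ (i : Fin 3) (p q : ℕ), Even (p + q) →
      evenForm (quad (genVal τ) i) p q = τ (i, 0) ^ p * τ (i, 1) ^ q := by
    intro i p q h
    obtain ⟨r, rfl | rfl⟩ := exists_parity p <;> obtain ⟨s, rfl | rfl⟩ := exists_parity q <;>
      try (exfalso; revert h; simp [parity_simps]; done)
    all_goals
      fin_cases i <;> simp [evenForm, quad, genVal, Nat.add_mod, Nat.mul_add_div] <;> ring
  have hod : ∀ (i : Fin 3) (p q : ℕ), Odd (p + q) →
      oddForm (quad (genVal τ) i) p q * τ (i, oddIndex p) = τ (i, 0) ^ p * τ (i, 1) ^ q := by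
    intro i p q h
    obtain ⟨r, rfl | rfl⟩ := exists_parity p <;> obtain ⟨s, rfl | rfl⟩ := exists_parity q <;>
      try (exfalso; revert h; simp [parity_simps]; done)
    all_goals
      fin_cases i <;>
        simp [oddForm, oddIndex, quad, genVal, Nat.add_mod, Nat.mul_add_div] <;> ring
  rw [Fintype.prod_prod_type, Fin.prod_univ_three]
  simp only [Fin.prod_univ_two]
  by_cases h : Even (e (0, 0) + e (0, 1))
  · have hE := even_of_isInvExp he h
    rw [normalForm, if_pos h, hev _ _ _ (hE 0), hev _ _ _ (hE 1), hev _ _ _ (hE 2)]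
  · have hO := odd_of_isInvExp he h
    rw [normalForm, if_neg h, ← hod _ _ _ (hO 0), ← hod _ _ _ (hO 1), ← hod _ _ _ (hO 2)]
    simp only [genVal]
    ring

end NormalForm

/-- The presentation of the invariants by the generators. -/
noncomputable def toTraces : MvPolynomial Gen ℂ →ₐ[ℂ] MvPolynomial (Fin 3 × Fin 2) ℂ :=
  aeval (genVal X)

theorem aeval_genVal_rel {R : Type*} [CommRing R] [Algebra ℂ R] (τ : Fin 3 × Fin 2 → R)
    {p : MvPolynomial Gen ℂ} (hp : Rel p) : aeval (genVal τ) p = 0 := by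
  cases hp <;> simp [a, b, c, genVal] <;> ring

theorem aeval_mk_rel {p : MvPolynomial Gen ℂ} (hp : Rel p) :
    aeval (fun x => Ideal.Quotient.mk relIdeal (X x)) p = 0 := by
  have h : aeval (fun x => Ideal.Quotient.mk relIdeal (X x)) = Ideal.Quotient.mkₐ ℂ relIdeal := by
    ext x
    simp
  rw [h]
  exact Ideal.Quotient.eq_zero_iff_mem.2 (Ideal.subset_span hp)

theorem exists_mk_monomial_eq_normalForm (m : Gen →₀ ℕ) (r : ℂ) :
    ∃ e s, IsInvExp e ∧ toTraces (monomial m r) = monomial e s ∧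
      Ideal.Quotient.mk relIdeal (monomial m r) =
        Ideal.Quotient.mk relIdeal (C s) *
          normalForm (fun x => Ideal.Quotient.mk relIdeal (X x)) e := by
  refine induction_on_monomial (motive := fun p => ∃ e s, IsInvExp e ∧
    toTraces p = monomial e s ∧ Ideal.Quotient.mk relIdeal p =
      Ideal.Quotient.mk relIdeal (C s) *
        normalForm (fun x => Ideal.Quotient.mk relIdeal (X x)) e) ?_ ?_ m r
  · intro r
    refine ⟨0, r, Or.inl (by simp), by simp [toTraces, algebraMap_eq], ?_⟩
    simp [normalForm, evenForm]
  · rintro p x ⟨e, s, he, h1, h2⟩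
    obtain ⟨he', h3⟩ := mul_normalForm (fun p => aeval_mk_rel) he x
    refine ⟨e + genDeg x, s, he', ?_, ?_⟩
    · rw [map_mul, h1, toTraces, aeval_X, genVal_X, monomial_mul, mul_one]
    · rw [map_mul, h2, ← h3]
      ring

/-- The binomial relations generate the kernel of the monomial map. -/
theorem ker_toTraces : RingHom.ker toTraces = relIdeal := by
  refine le_antisymm (fun p hp => ?_) (Ideal.span_le.2 fun p hp => ?_)
  · let L : MvPolynomial (Fin 3 × Fin 2) ℂ →ₗ[ℂ] MvPolynomial Gen ℂ ⧸ relIdeal :=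
      (basisMonomials _ ℂ).constr ℂ (normalForm fun x => Ideal.Quotient.mk relIdeal (X x))
    have hL : ∀ e s, L (monomial e s) =
        Ideal.Quotient.mk relIdeal (C s) *
          normalForm (fun x => Ideal.Quotient.mk relIdeal (X x)) e := fun e s => by
      have h := (basisMonomials (Fin 3 × Fin 2) ℂ).constr_basis ℂ
        (normalForm fun x => Ideal.Quotient.mk relIdeal (X x)) e
      rw [coe_basisMonomials] at h
      have h' : Ideal.Quotient.mk relIdeal (C s) = algebraMap ℂ _ s := rfl
      rw [← h, h', ← Algebra.smul_def, ← map_smul, smul_monomial, smul_eq_mul, mul_one]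
    have key : ∀ p, L (toTraces p) = Ideal.Quotient.mk relIdeal p := fun p => by
      induction p using MvPolynomial.induction_on' with
      | monomial m r =>
        obtain ⟨e, s, -, h1, h2⟩ := exists_mk_monomial_eq_normalForm m r
        rw [h1, h2, hL]
      | add p q hp hq => rw [map_add, map_add, map_add, hp, hq]
    rw [← Ideal.Quotient.eq_zero_iff_mem, ← key, (RingHom.mem_ker).1 hp, map_zero]
  · exact aeval_genVal_rel X hp

/-- The signs by which a representation into `{±1}` changes the six traces. -/
def twist (σ : Fin 2 → ℂ) : Fin 3 × Fin 2 → ℂ := fun v => ![σ 0, σ 1, σ 0 * σ 1] v.1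

/-- Averaging over the four sign changes projects onto the range of `toTraces`. -/
theorem exists_toTraces_eval (p : MvPolynomial (Fin 3 × Fin 2) ℂ) :
    ∃ q, ∀ τ, eval τ (toTraces q) =
      1 / 4 * (eval τ p + eval (twist ![1, -1] * τ) p + eval (twist ![-1, 1] * τ) p +
        eval (twist ![-1, -1] * τ) p) := by
  induction p using MvPolynomial.induction_on' with
  | monomial e r =>
    have hmon : ∀ σ τ, eval (twist σ * τ) (monomial e r) =
        (σ 0 ^ (e (0, 0) + e (0, 1)) * σ 1 ^ (e (1, 0) + e (1, 1)) *
          (σ 0 * σ 1) ^ (e (2, 0) + e (2, 1))) * eval τ (monomial e r) := fun σ τ => by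
      rw [eval_monomial, eval_monomial, Finsupp.prod_fintype _ _ (by simp),
        Finsupp.prod_fintype _ _ (by simp)]
      simp only [Pi.mul_apply, mul_pow, Finset.prod_mul_distrib]
      rw [Fintype.prod_prod_type (fun v => twist σ v ^ e v)]
      simp [Fin.prod_univ_three, twist]
      ring
    simp only [hmon]
    by_cases he : IsInvExp e
    · refine ⟨C r * normalForm X e, fun τ => ?_⟩
      have h1 : toTraces (normalForm X e) = normalForm (genVal X) e := by
        rw [← AlgHom.coe_toRingHom, map_normalForm]
        congr 1
        ext x
        simp [toTraces]
      rw [map_mul, map_mul, h1, normalForm_genVal X he]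
      simp only [toTraces, ← algebraMap_eq, AlgHom.commutes]
      rw [algebraMap_eq, eval_C, map_prod, eval_monomial, Finsupp.prod_fintype _ _ (by simp)]
      simp only [map_pow, eval_X]
      rcases he with h | h <;>
      · simp [(h 0).neg_one_pow, (h 1).neg_one_pow, (h 2).neg_one_pow]
        ring
    · refine ⟨0, fun τ => ?_⟩
      have hcases : ∀ n : ℕ, (Even n ∧ (-1 : ℂ) ^ n = 1) ∨ (Odd n ∧ (-1 : ℂ) ^ n = -1) :=
        fun n => (Nat.even_or_odd n).imp (fun h => ⟨h, h.neg_one_pow⟩) fun h => ⟨h, h.neg_one_pow⟩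
      rw [map_zero, map_zero]
      simp only [Matrix.cons_val_zero, Matrix.cons_val_one, one_pow, one_mul, mul_one, neg_mul,
        neg_neg]
      -- If the three block parities differ, the monomial transforms by a nontrivial character of
      -- the sign group, whose four values sum to zero.
      rcases hcases (e (0, 0) + e (0, 1)) with ⟨h, h'⟩ | ⟨h, h'⟩ <;>
      rcases hcases (e (1, 0) + e (1, 1)) with ⟨k, k'⟩ | ⟨k, k'⟩ <;>
      rcases hcases (e (2, 0) + e (2, 1)) with ⟨l, l'⟩ | ⟨l, l'⟩ <;>
      rw [h', k', l'] <;>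
      first
        | ring1
        | (refine absurd (Or.inl fun i => ?_) he; fin_cases i <;> assumption)
        | (refine absurd (Or.inr fun i => ?_) he; fin_cases i <;> assumption)
  | add p q hp hq =>
    obtain ⟨p', hp⟩ := hp
    obtain ⟨q', hq⟩ := hq
    refine ⟨p' + q', fun τ => ?_⟩
    simp only [map_add, hp, hq]
    ring

/-! ### Pairs of representations into `SL(2, ℂ)` -/

/-- Pairs of representations of `F₂` into `SL(2, ℂ)`. -/
abbrev SLPair : Type := Fin 2 → FreeGroup (Fin 2) →* SL(2, ℂ)

/-- The representation into `SO(4, ℂ)` given by a pair of representations into `SL(2, ℂ)`. -/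
noncomputable def toSO4 (ρ : SLPair) : FreeGroup (Fin 2) →* SO4 := phi.comp ((ρ 0).prod (ρ 1))

theorem toSO4_apply (ρ : SLPair) (w : FreeGroup (Fin 2)) : toSO4 ρ w = phi (ρ 0 w, ρ 1 w) := rfl

theorem toSO4_surjective : Function.Surjective toSO4 := by
  intro ψ
  choose s hs using phi_surjective
  refine ⟨![FreeGroup.lift fun i => (s (ψ (FreeGroup.of i))).1,
    FreeGroup.lift fun i => (s (ψ (FreeGroup.of i))).2], ?_⟩
  ext1 i
  simp [toSO4_apply, hs]

/-- The six traces of a pair of representations. -/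
def traces (ρ : SLPair) : Fin 3 × Fin 2 → ℂ := fun v =>
  ![trGen 0 v.2 ρ, trGen 1 v.2 ρ, trProd v.2 ρ] v.1

theorem value_eq_genVal (ρ : SLPair) (x : Gen) : x.value ρ = genVal (traces ρ) x := by
  cases x with
  | a i jk => induction jk with | _ j k => fin_cases i <;> simp [genVal, Gen.value, traces]
  | b jk => induction jk with | _ j k => simp [genVal, Gen.value, traces]
  | c i j k => simp [genVal, Gen.value, traces]

/-- Conjugation of a pair of representations. -/
def conjPair (g : Fin 2 → SL(2, ℂ)) (ρ : SLPair) : SLPair :=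
  fun j => (MulAut.conj (g j)).toMonoidHom.comp (ρ j)

theorem toSO4_conjPair (g : Fin 2 → SL(2, ℂ)) (ρ : SLPair) :
    toSO4 (conjPair g ρ) = (MulAut.conj (phi (g 0, g 1))).toMonoidHom.comp (toSO4 ρ) := by
  ext1 i
  simp [toSO4_apply, conjPair, ← map_inv, ← map_mul]

theorem traces_conjPair (g : Fin 2 → SL(2, ℂ)) (ρ : SLPair) :
    traces (conjPair g ρ) = traces ρ := by
  have h : ∀ j w, (conjPair g ρ j w).1.trace = (ρ j w).1.trace := fun j w => by
    have h1 : conjPair g ρ j w = g j * ρ j w * (g j)⁻¹ := rfl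
    rw [h1, Matrix.SpecialLinearGroup.coe_mul, Matrix.trace_mul_comm,
      ← Matrix.SpecialLinearGroup.coe_mul, inv_mul_cancel_left]
  ext ⟨i, j⟩
  fin_cases i <;> exact h j _

/-- The pair of representations with prescribed values on the generators. -/
def pairOf (A B : Fin 2 → SL(2, ℂ)) : SLPair := fun j => FreeGroup.lift ![A j, B j]

theorem pairOf_of_zero (A B : Fin 2 → SL(2, ℂ)) (j : Fin 2) :
    pairOf A B j (FreeGroup.of 0) = A j := by
  simp [pairOf]

theorem pairOf_of_one (A B : Fin 2 → SL(2, ℂ)) (j : Fin 2) :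
    pairOf A B j (FreeGroup.of 1) = B j := by
  simp [pairOf]

theorem pairOf_eta (ρ : SLPair) :
    pairOf (fun j => ρ j (FreeGroup.of 0)) (fun j => ρ j (FreeGroup.of 1)) = ρ := by
  funext j
  ext1 i
  fin_cases i
  · exact pairOf_of_zero ..
  · exact pairOf_of_one ..

theorem traces_pairOf (A B : Fin 2 → SL(2, ℂ)) (v : Fin 3 × Fin 2) : traces (pairOf A B) v =
    ![(A v.2).1.trace, (B v.2).1.trace, ((A v.2).1 * (B v.2).1).trace] v.1 := by
  simp only [traces, trGen, trProd, map_mul, pairOf_of_zero, pairOf_of_one,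
    Matrix.SpecialLinearGroup.coe_mul]

/-! ### The normal form of pairs -/

/-- The trace of `A⁻¹ B` in terms of those of `A`, `B` and `A B`. -/
def invTrace (τ : Fin 3 × Fin 2 → ℂ) (j : Fin 2) : ℂ := τ (0, j) * τ (1, j) - τ (2, j)

/-- The first matrix of the normal form of a pair. -/
def cyclicFst (τ : Fin 3 × Fin 2 → ℂ) (j : Fin 2) : Matrix (Fin 2) (Fin 2) ℂ :=
  !![0, -1; 1, τ (0, j)]

/-- The second matrix of the normal form of a pair. -/
def cyclicSnd (τ : Fin 3 × Fin 2 → ℂ) (t : Fin 2 → ℂ) (j : Fin 2) : Matrix (Fin 2) (Fin 2) ℂ :=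
  !![0, t j - invTrace τ j; t j, τ (1, j)]

/-- `t j` and its conjugate are the eigenvalues of `A⁻¹ B`. -/
def IsRoot (τ : Fin 3 × Fin 2 → ℂ) (t : Fin 2 → ℂ) : Prop :=
  ∀ j, t j ^ 2 = invTrace τ j * t j - 1

theorem exists_isRoot (τ : Fin 3 × Fin 2 → ℂ) : ∃ t, IsRoot τ t := by
  have h : ∀ j, ∃ t : ℂ, t ^ 2 = invTrace τ j * t - 1 := fun j => by
    obtain ⟨s, hs⟩ := IsAlgClosed.exists_pow_nat_eq (invTrace τ j ^ 2 - 4) (n := 2) (by norm_num)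
    exact ⟨(invTrace τ j + s) / 2, by linear_combination hs / 4⟩
  choose t ht using h
  exact ⟨t, ht⟩

theorem det_cyclicFst (τ : Fin 3 × Fin 2 → ℂ) (j : Fin 2) : (cyclicFst τ j).det = 1 := by
  simp [cyclicFst, Matrix.det_fin_two_of]

theorem det_cyclicSnd {τ : Fin 3 × Fin 2 → ℂ} {t : Fin 2 → ℂ} (h : IsRoot τ t) (j : Fin 2) :
    (cyclicSnd τ t j).det = 1 := by
  simp only [cyclicSnd, Matrix.det_fin_two_of]
  linear_combination -h j

/-- A matrix of determinant one as an element of `SL(2, ℂ)`. -/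
def toSL (A : Matrix (Fin 2) (Fin 2) ℂ) (hA : A.det = 1) : SL(2, ℂ) := ⟨A, hA⟩

@[simp]
theorem coe_toSL (A : Matrix (Fin 2) (Fin 2) ℂ) (hA : A.det = 1) : (toSL A hA).1 = A := rfl

/-- The normal form realises any six values. Hence the six traces are algebraically independent. -/
theorem traces_surjective : Function.Surjective traces := by
  intro τ
  obtain ⟨t, ht⟩ := exists_isRoot τ
  refine ⟨pairOf (fun j => toSL _ (det_cyclicFst τ j))
    (fun j => toSL _ (det_cyclicSnd ht j)), ?_⟩
  ext ⟨i, j⟩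
  rw [traces_pairOf]
  fin_cases i <;> simp [cyclicSnd, cyclicFst, Matrix.trace_fin_two, invTrace]
  ring

/-- The functions of the traces and the roots that are affine in each of the two roots. -/
def rootAlgebra : Subalgebra ℂ ((Fin 3 × Fin 2 → ℂ) → (Fin 2 → ℂ) → ℂ) where
  carrier := {h | ∃ p₀ p₁ p₂ p₃ : MvPolynomial (Fin 3 × Fin 2) ℂ, ∀ τ t, IsRoot τ t →
    h τ t = eval τ p₀ + eval τ p₁ * t 0 + eval τ p₂ * t 1 + eval τ p₃ * (t 0 * t 1)}
  add_mem' := by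
    rintro f g ⟨p₀, p₁, p₂, p₃, hp⟩ ⟨q₀, q₁, q₂, q₃, hq⟩
    refine ⟨p₀ + q₀, p₁ + q₁, p₂ + q₂, p₃ + q₃, fun τ t h => ?_⟩
    simp only [Pi.add_apply, hp τ t h, hq τ t h, map_add]
    ring
  mul_mem' := by
    rintro f g ⟨p₀, p₁, p₂, p₃, hp⟩ ⟨q₀, q₁, q₂, q₃, hq⟩
    let w : Fin 2 → MvPolynomial (Fin 3 × Fin 2) ℂ := fun j => X (0, j) * X (1, j) - X (2, j)
    have hw : ∀ τ j, eval τ (w j) = invTrace τ j := fun τ j => by simp [w, invTrace]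
    -- Expand the product and reduce with tⱼ² = wⱼtⱼ - 1.
    refine ⟨p₀ * q₀ - p₁ * q₁ - p₂ * q₂ + p₃ * q₃,
      p₀ * q₁ + p₁ * q₀ + p₁ * q₁ * w 0 - p₂ * q₃ - p₃ * q₂ - p₃ * q₃ * w 0,
      p₀ * q₂ + p₂ * q₀ + p₂ * q₂ * w 1 - p₁ * q₃ - p₃ * q₁ - p₃ * q₃ * w 1,
      p₀ * q₃ + p₃ * q₀ + p₁ * q₂ + p₂ * q₁ + (p₁ * q₃ + p₃ * q₁) * w 0 +
        (p₂ * q₃ + p₃ * q₂) * w 1 + p₃ * q₃ * w 0 * w 1, fun τ t h => ?_⟩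
    have h0 := h 0
    have h1 := h 1
    simp only [Pi.mul_apply, hp τ t h, hq τ t h, map_add, map_sub, map_mul, hw]
    generalize eval τ p₀ = a₀, eval τ p₁ = a₁, eval τ p₂ = a₂, eval τ p₃ = a₃, eval τ q₀ = b₀,
      eval τ q₁ = b₁, eval τ q₂ = b₂, eval τ q₃ = b₃
    linear_combination (a₁ * b₁ + (a₁ * b₃ + a₃ * b₁) * t 1 + a₃ * b₃ * t 1 ^ 2) * h0 +
      (a₂ * b₂ + (a₂ * b₃ + a₃ * b₂) * t 0 + a₃ * b₃ * (invTrace τ 0 * t 0 - 1)) * h1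
  algebraMap_mem' r := ⟨C r, 0, 0, 0, fun τ t _ => by simp⟩

theorem trace_mem_rootAlgebra (v : Fin 3 × Fin 2) : (fun τ _ => τ v) ∈ rootAlgebra :=
  ⟨X v, 0, 0, 0, fun τ t _ => by simp⟩

theorem root_mem_rootAlgebra (j : Fin 2) : (fun _ t => t j) ∈ rootAlgebra := by
  fin_cases j
  · exact ⟨0, 1, 0, 0, fun τ t _ => by simp⟩
  · exact ⟨0, 0, 1, 0, fun τ t _ => by simp⟩

theorem cyclicFst_mem_rootAlgebra (j p q : Fin 2) :
    (fun τ _ => cyclicFst τ j p q) ∈ rootAlgebra := by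
  fin_cases p <;> fin_cases q
  · exact zero_mem _
  · exact neg_mem (one_mem _)
  · exact one_mem _
  · exact trace_mem_rootAlgebra _

theorem cyclicSnd_mem_rootAlgebra (j p q : Fin 2) :
    (fun τ t => cyclicSnd τ t j p q) ∈ rootAlgebra := by
  fin_cases p <;> fin_cases q
  · exact zero_mem _
  · exact sub_mem (root_mem_rootAlgebra j) (sub_mem (mul_mem (trace_mem_rootAlgebra _)
      (trace_mem_rootAlgebra _)) (trace_mem_rootAlgebra _))
  · exact root_mem_rootAlgebra j
  · exact trace_mem_rootAlgebra _

theorem spinMatrix_mem_of_entries_mem {α β : Type*} {S : Subalgebra ℂ (α → β → ℂ)}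
    {A B : α → β → Matrix (Fin 2) (Fin 2) ℂ} (hA : ∀ p q, (fun x y => A x y p q) ∈ S)
    (hB : ∀ p q, (fun x y => B x y p q) ∈ S) (k l : Fin 4) :
    (fun x y => spinMatrix (A x y) (B x y) k l) ∈ S := by
  have h : (fun x y => spinMatrix (A x y) (B x y) k l) = (1 / 2 : ℂ) •
      ∑ p : Fin 2 × Fin 2, ∑ q : Fin 2 × Fin 2,
        ((frame.transpose * (detForm ⊗ₖ detForm)) k p * frame q l) •
          ((fun x y => A x y p.1 q.1) * fun x y => B x y p.2 q.2) := by
    funext x y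
    simp only [spinMatrix_apply, Pi.smul_apply, Finset.sum_apply, Pi.mul_apply, smul_eq_mul]
    congr 1
    refine Finset.sum_congr rfl fun p _ => Finset.sum_congr rfl fun q _ => ?_
    ring
  rw [h]
  exact S.smul_mem (sum_mem fun p _ => sum_mem fun q _ =>
    S.smul_mem (mul_mem (hA _ _) (hB _ _)) _) _

/-- The average of a function in `rootAlgebra` over the roots is a polynomial in the traces. -/
theorem exists_eval_of_mem_rootAlgebra {h : (Fin 3 × Fin 2 → ℂ) → (Fin 2 → ℂ) → ℂ}
    (hh : h ∈ rootAlgebra) {f : (Fin 3 × Fin 2 → ℂ) → ℂ} (hf : ∀ τ t, IsRoot τ t → h τ t = f τ) :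
    ∃ p, ∀ τ, f τ = eval τ p := by
  obtain ⟨p₀, p₁, p₂, p₃, hp⟩ := hh
  let w : Fin 2 → MvPolynomial (Fin 3 × Fin 2) ℂ := fun j => X (0, j) * X (1, j) - X (2, j)
  have hw : ∀ τ j, eval τ (w j) = invTrace τ j := fun τ j => by simp [w, invTrace]
  -- The roots t and w - t have mean w / 2, so averaging over the four choices replaces t₀, t₁ and
  -- t₀t₁ by w₀/2, w₁/2 and w₀w₁/4.
  refine ⟨p₀ + C (1 / 2) * (p₁ * w 0 + p₂ * w 1) + C (1 / 4) * (p₃ * w 0 * w 1), fun τ => ?_⟩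
  obtain ⟨t, ht⟩ := exists_isRoot τ
  have key : ∀ a b : ℂ, a ^ 2 = invTrace τ 0 * a - 1 → b ^ 2 = invTrace τ 1 * b - 1 →
      f τ = eval τ p₀ + eval τ p₁ * a + eval τ p₂ * b + eval τ p₃ * (a * b) := fun a b ha hb => by
    have h' : IsRoot τ ![a, b] := fun j => by fin_cases j <;> assumption
    rw [← hf τ _ h', hp τ _ h']
    simp
  have e0 : (invTrace τ 0 - t 0) ^ 2 = invTrace τ 0 * (invTrace τ 0 - t 0) - 1 := by
    linear_combination ht 0
  have e1 : (invTrace τ 1 - t 1) ^ 2 = invTrace τ 1 * (invTrace τ 1 - t 1) - 1 := by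
    linear_combination ht 1
  simp only [map_add, map_mul, eval_C, hw]
  linear_combination 1 / 4 * (key _ _ (ht 0) (ht 1) + key _ _ e0 (ht 1) + key _ _ (ht 0) e1 +
    key _ _ e0 e1)

/-- The entries of the images of the generators, for quadruples of matrices. -/
noncomputable def spinEntries (A B : Fin 2 → Matrix (Fin 2) (Fin 2) ℂ) :
    Fin 2 × Fin 4 × Fin 4 → ℂ :=
  fun x => ![spinMatrix (A 0) (A 1), spinMatrix (B 0) (B 1)] x.1 x.2.1 x.2.2

theorem spinEntries_eq (A B : Fin 2 → SL(2, ℂ)) (x : Fin 2 × Fin 4 × Fin 4) :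
    spinEntries (fun j => (A j).1) (fun j => (B j).1) x =
      (toSO4 (pairOf A B) (FreeGroup.of x.1)).1 x.2.1 x.2.2 := by
  obtain ⟨m, k, l⟩ := x
  fin_cases m
  · simp [spinEntries, toSO4_apply, pairOf_of_zero, phi]
  · simp [spinEntries, toSO4_apply, pairOf_of_one, phi]

theorem continuous_spinEntries {α : Type*} [TopologicalSpace α]
    {A B : α → Fin 2 → Matrix (Fin 2) (Fin 2) ℂ} (hA : ∀ j, Continuous fun x => A x j)
    (hB : ∀ j, Continuous fun x => B x j) : Continuous fun x => spinEntries (A x) (B x) := by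
  have h : ∀ (C D : α → Matrix (Fin 2) (Fin 2) ℂ), Continuous C → Continuous D → ∀ k l,
      Continuous fun x => spinMatrix (C x) (D x) k l := fun C D hC hD k l => by
    simp only [spinMatrix_apply]
    have := fun p q => hC.matrix_elem p q
    have := fun p q => hD.matrix_elem p q
    fun_prop
  refine continuous_pi fun ⟨m, k, l⟩ => ?_
  fin_cases m
  · exact h _ _ (hA 0) (hA 1) k l
  · exact h _ _ (hB 0) (hB 1) k l

theorem eval_cyclic_mem_rootAlgebra (G : MvPolynomial (Fin 2 × Fin 4 × Fin 4) ℂ) :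
    (fun τ t => eval (spinEntries (cyclicFst τ) (cyclicSnd τ t)) G) ∈ rootAlgebra := by
  induction G using MvPolynomial.induction_on with
  | C r =>
    simp only [eval_C]
    exact algebraMap_mem rootAlgebra r
  | add p q hp hq =>
    simp only [map_add]
    exact add_mem hp hq
  | mul_X p x hp =>
    simp only [map_mul, eval_X]
    refine mul_mem hp ?_
    obtain ⟨m, k, l⟩ := x
    fin_cases m
    · exact spinMatrix_mem_of_entries_mem (cyclicFst_mem_rootAlgebra 0)
        (cyclicFst_mem_rootAlgebra 1) k l
    · exact spinMatrix_mem_of_entries_mem (cyclicSnd_mem_rootAlgebra 0)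
        (cyclicSnd_mem_rootAlgebra 1) k l

theorem aeval_fun_apply {α σ : Type*} (F : σ → α → ℂ) (G : MvPolynomial σ ℂ) (x : α) :
    (aeval F G : α → ℂ) x = eval (fun i => F i x) G := by
  induction G using MvPolynomial.induction_on with
  | C r => simp
  | add p q hp hq => simp [hp, hq]
  | mul_X p i hp => simp [hp]

/-! ### Invariant regular functions as polynomials in the traces -/

theorem exists_eval_of_mem_homCoordRing {f : (FreeGroup (Fin 2) →* SO4) → ℂ}
    (hf : f ∈ homCoordRing (Matrix.specialOrthogonalGroup (Fin 4) ℂ).subtype 2) :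
    ∃ G : MvPolynomial (Fin 2 × Fin 4 × Fin 4) ℂ, ∀ ψ, f ψ =
      eval (fun x : Fin 2 × Fin 4 × Fin 4 => (ψ (FreeGroup.of x.1)).1 x.2.1 x.2.2) G := by
  obtain ⟨G, rfl⟩ := hf
  exact ⟨G, aeval_fun_apply _ G⟩

/-- Invariant regular functions pull back to polynomials in the six traces. -/
theorem exists_eval_traces (f : charRingSO4) :
    ∃ p : MvPolynomial (Fin 3 × Fin 2) ℂ, ∀ ρ, f.1 (toSO4 ρ) = eval (traces ρ) p := by
  obtain ⟨f, hf, hinv⟩ := f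
  change ∃ p : MvPolynomial (Fin 3 × Fin 2) ℂ, ∀ ρ, f (toSO4 ρ) = eval (traces ρ) p
  obtain ⟨G, hG⟩ := exists_eval_of_mem_homCoordRing hf
  have hfG : ∀ A B : Fin 2 → SL(2, ℂ), eval (spinEntries (fun j => (A j).1) fun j => (B j).1) G =
      f (toSO4 (pairOf A B)) := fun A B => by
    rw [hG, funext (spinEntries_eq A B)]
  have hpair : ∀ (P A B A' B' : Fin 2 → Matrix (Fin 2) (Fin 2) ℂ), (∀ j, (P j).det = 1) →
      (∀ j, (A j).det = 1) → (∀ j, (B j).det = 1) → (∀ j, A j * P j = P j * A' j) →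
      (∀ j, B j * P j = P j * B' j) →
      eval (spinEntries A B) G = eval (spinEntries A' B') G := by
    intro P A B A' B' hP hA hB hAA' hBB'
    have hdet : ∀ {P A A' : Matrix (Fin 2) (Fin 2) ℂ}, P.det = 1 → A.det = 1 →
        A * P = P * A' → A'.det = 1 := fun hP hA h => by
      simpa [Matrix.det_mul, hP, hA, eq_comm] using congrArg Matrix.det h
    have e1 := hfG (fun j => toSL _ (hA j)) (fun j => toSL _ (hB j))
    have e2 := hfG (fun j => toSL _ (hdet (hP j) (hA j) (hAA' j)))
      (fun j => toSL _ (hdet (hP j) (hB j) (hBB' j)))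
    refine e1.trans (Eq.trans ?_ e2.symm)
    rw [← hinv (phi (toSL _ (hP 0), toSL _ (hP 1)))
        (toSO4 (pairOf (fun j => toSL _ (hdet (hP j) (hA j) (hAA' j))) _)),
      ← toSO4_conjPair (fun j => toSL _ (hP j))]
    congr 2
    have hc : ∀ {P A A' : SL(2, ℂ)}, A.1 * P.1 = P.1 * A'.1 → A = P * A' * P⁻¹ :=
      fun h => eq_mul_inv_of_mul_eq (Subtype.ext h)
    funext j
    ext1 i
    fin_cases i
    · simp only [conjPair, MonoidHom.comp_apply, MulEquiv.coe_toMonoidHom, MulAut.conj_apply,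
        Fin.zero_eta, pairOf_of_zero]
      exact hc (hAA' j)
    · simp only [conjPair, MonoidHom.comp_apply, MulEquiv.coe_toMonoidHom, MulAut.conj_apply,
        Fin.mk_one, pairOf_of_one]
      exact hc (hBB' j)
  -- The two SL(2) factors are normalised in turn: first factor 0 with the other fixed, then factor
  -- 1 with factor 0 already in normal form.
  have hred : ∀ (A B : Fin 2 → SL(2, ℂ)) t, IsRoot (traces (pairOf A B)) t →
      eval (spinEntries (fun j => (A j).1) fun j => (B j).1) G =
        eval (spinEntries (cyclicFst (traces (pairOf A B)))
          (cyclicSnd (traces (pairOf A B)) t)) G := by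
    intro A B t ht
    have h0 : PairInvariant fun C D =>
        eval (spinEntries ![C, (A 1).1] ![D, (B 1).1]) G := by
      intro P C D C' D' hP hC hD hCC' hDD'
      refine hpair ![P, 1] _ _ _ _ ?_ ?_ ?_ ?_ ?_ <;> simp [Fin.forall_fin_two, *]
    have h1 : PairInvariant fun C D =>
        eval (spinEntries ![cyclicFst (traces (pairOf A B)) 0, C]
          ![cyclicSnd (traces (pairOf A B)) t 0, D]) G := by
      intro P C D C' D' hP hC hD hCC' hDD'
      refine hpair ![1, P] _ _ _ _ ?_ ?_ ?_ ?_ ?_ <;>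
        simp [Fin.forall_fin_two, det_cyclicFst, det_cyclicSnd ht, *]
    have c0 : Continuous (Function.uncurry fun C D =>
        eval (spinEntries ![C, (A 1).1] ![D, (B 1).1]) G) := by
      refine (continuous_eval G).comp (continuous_spinEntries (fun j => ?_) fun j => ?_) <;>
        fin_cases j <;> simp <;> fun_prop
    have c1 : Continuous (Function.uncurry fun C D =>
        eval (spinEntries ![cyclicFst (traces (pairOf A B)) 0, C]
          ![cyclicSnd (traces (pairOf A B)) t 0, D]) G) := by
      refine (continuous_eval G).comp (continuous_spinEntries (fun j => ?_) fun j => ?_) <;>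
        fin_cases j <;> simp <;> fun_prop
    have r0 := h0.eq_normalForm c0 (A 0).2 (B 0).2 rfl (t := t 0)
      (by simpa [invTrace, traces_pairOf] using ht 0)
    have r1 := h1.eq_normalForm c1 (A 1).2 (B 1).2 rfl (t := t 1)
      (by simpa [invTrace, traces_pairOf] using ht 1)
    have eta : ∀ C : Fin 2 → Matrix (Fin 2) (Fin 2) ℂ, C = ![C 0, C 1] := fun C => by
      ext j : 1
      fin_cases j <;> rfl
    rw [eta fun j => (A j).1, eta fun j => (B j).1, eta (cyclicFst (traces (pairOf A B))),
      eta (cyclicSnd (traces (pairOf A B)) t)]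
    refine r0.trans (Eq.trans ?_ (r1.trans ?_)) <;>
      simp [cyclicFst, cyclicSnd, invTrace, traces_pairOf]
  -- A pair ρ and the chosen pair with the same traces share a normal form, so f takes the same
  -- value on both.
  choose s hs using traces_surjective
  obtain ⟨p, hp⟩ := exists_eval_of_mem_rootAlgebra (eval_cyclic_mem_rootAlgebra G)
    (f := fun τ => f (toSO4 (s τ)))
    fun τ t ht => by
      have h := hred (fun j => s τ j (FreeGroup.of 0)) (fun j => s τ j (FreeGroup.of 1)) t
      rw [hfG, pairOf_eta, hs] at h
      exact (h ht).symm
  refine ⟨p, fun ρ => ?_⟩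
  obtain ⟨t, ht⟩ := exists_isRoot (traces ρ)
  have h := hred (fun j => ρ j (FreeGroup.of 0)) (fun j => ρ j (FreeGroup.of 1)) t
  have h' := hred (fun j => s (traces ρ) j (FreeGroup.of 0))
    (fun j => s (traces ρ) j (FreeGroup.of 1)) t
  rw [hfG, pairOf_eta] at h h'
  rw [hs] at h'
  rw [h ht, ← h' ht, hp]

/-! ### Sign changes -/

/-- The scalar matrix `s`, where `s ^ 2 = 1`. -/
def signSL (s : ℂ) (hs : s ^ 2 = 1) : SL(2, ℂ) :=
  toSL (s • 1) (by rw [Matrix.det_smul, Fintype.card_fin, hs, Matrix.det_one, one_mul])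

theorem phi_signSL_mul (s : ℂ) (hs : s ^ 2 = 1) (A B : SL(2, ℂ)) :
    phi (signSL s hs * A, signSL s hs * B) = phi (A, B) := by
  refine Subtype.ext ?_
  change spinMatrix ((s • (1 : Matrix (Fin 2) (Fin 2) ℂ)) * A.1)
    ((s • (1 : Matrix (Fin 2) (Fin 2) ℂ)) * B.1) = spinMatrix A.1 B.1
  ext k l
  simp only [spinMatrix_apply, Matrix.smul_mul, one_mul, Matrix.smul_apply, smul_eq_mul]
  congr 1
  refine Finset.sum_congr rfl fun p _ => Finset.sum_congr rfl fun q _ => ?_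
  linear_combination (frame.transpose * (detForm ⊗ₖ detForm)) k p *
    (A.1 p.1 q.1 * B.1 p.2 q.2) * frame q l * hs

/-- Multiplication of a pair of representations by a representation into `{±1}`. -/
def twistPair (σ : Fin 2 → ℂ) (hσ : ∀ i, σ i ^ 2 = 1) (ρ : SLPair) : SLPair :=
  pairOf (fun j => signSL (σ 0) (hσ 0) * ρ j (FreeGroup.of 0))
    (fun j => signSL (σ 1) (hσ 1) * ρ j (FreeGroup.of 1))

theorem toSO4_twistPair (σ : Fin 2 → ℂ) (hσ : ∀ i, σ i ^ 2 = 1) (ρ : SLPair) :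
    toSO4 (twistPair σ hσ ρ) = toSO4 ρ := by
  ext1 i
  rw [toSO4_apply, toSO4_apply]
  fin_cases i
  · simp only [twistPair, Fin.zero_eta, pairOf_of_zero, phi_signSL_mul]
  · simp only [twistPair, Fin.mk_one, pairOf_of_one, phi_signSL_mul]

theorem traces_twistPair (σ : Fin 2 → ℂ) (hσ : ∀ i, σ i ^ 2 = 1) (ρ : SLPair) :
    traces (twistPair σ hσ ρ) = twist σ * traces ρ := by
  have h : ∀ s hs (A : SL(2, ℂ)), (signSL s hs * A).1 = s • A.1 := fun s hs A => by
    rw [Matrix.SpecialLinearGroup.coe_mul, signSL, coe_toSL, Matrix.smul_mul, one_mul]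
  ext ⟨i, j⟩
  rw [twistPair, traces_pairOf, ← pairOf_eta ρ, Pi.mul_apply, traces_pairOf, pairOf_eta]
  simp only [h, Matrix.smul_mul, Matrix.mul_smul, Matrix.trace_smul, smul_eq_mul]
  fin_cases i <;> simp [twist]
  ring

/-- Invariant regular functions pull back to the polynomials in the generators. -/
theorem exists_toTraces_eq (f : charRingSO4) :
    ∃ q : MvPolynomial Gen ℂ, ∀ ρ, f.1 (toSO4 ρ) = eval (traces ρ) (toTraces q) := by
  obtain ⟨p, hp⟩ := exists_eval_traces f
  obtain ⟨q, hq⟩ := exists_toTraces_eval p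
  have h : ∀ σ : Fin 2 → ℂ, (∀ i, σ i ^ 2 = 1) → ∀ ρ,
      eval (twist σ * traces ρ) p = f.1 (toSO4 ρ) := fun σ hσ ρ => by
    rw [← traces_twistPair σ hσ, ← hp, toSO4_twistPair]
  refine ⟨q, fun ρ => ?_⟩
  rw [hq, h, h, h, ← hp]
  · ring
  all_goals simp [Fin.forall_fin_two]

/-! ### The generators as functions -/

/-- Pullback of functions to pairs of representations into `SL(2, ℂ)`. -/
noncomputable def pullback : ((FreeGroup (Fin 2) →* SO4) → ℂ) →ₐ[ℂ] (SLPair → ℂ) :=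
  AlgHom.pi fun ρ => Pi.evalAlgHom ℂ _ (toSO4 ρ)

/-- The pullbacks of the regular functions on `Hom(F₂, SO(4, ℂ))`. -/
noncomputable def pulledBack : Subalgebra ℂ (SLPair → ℂ) :=
  (homCoordRing (Matrix.specialOrthogonalGroup (Fin 4) ℂ).subtype 2).map pullback

/-- A matrix entry as a function of the pair of representations. -/
def entry (m j p q : Fin 2) : SLPair → ℂ := fun ρ => (ρ j (FreeGroup.of m)).1 p q

/-- The inverse of `frame` is ½ `frame`ᵀ(J ⊗ J) with J = `detForm`, so the change of basis can be
undone: products of an entry of A and an entry of B are linear in the entries of the image. -/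
theorem kronecker_eq_of_spinMatrix (A B : Matrix (Fin 2) (Fin 2) ℂ) :
    A ⊗ₖ B = (1 / 2 : ℂ) •
      (frame * spinMatrix A B * (frame.transpose * (detForm ⊗ₖ detForm))) := by
  have h : frame * (frame.transpose * (detForm ⊗ₖ detForm) * (A ⊗ₖ B) * frame) *
      (frame.transpose * (detForm ⊗ₖ detForm)) = (frame * frame.transpose) *
        (detForm ⊗ₖ detForm) * (A ⊗ₖ B) * ((frame * frame.transpose) * (detForm ⊗ₖ detForm)) := by
    simp only [Matrix.mul_assoc]
  rw [spinMatrix, Matrix.mul_smul, Matrix.smul_mul, h, frame_mul_transpose, Matrix.smul_mul,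
    detForm_mul_self, smul_smul, Matrix.smul_mul, Matrix.mul_smul, one_mul, mul_one, smul_smul,
    smul_smul]
  norm_num

theorem entry_mul_entry_mem (m p q r s : Fin 2) :
    entry m 0 p q * entry m 1 r s ∈ pulledBack := by
  have hM : ∀ k l, (fun ρ => (toSO4 ρ (FreeGroup.of m)).1 k l) ∈ pulledBack := fun k l =>
    ⟨fun ψ => (ψ (FreeGroup.of m)).1 k l, ⟨X (m, k, l), by simp⟩, rfl⟩
  have h : entry m 0 p q * entry m 1 r s = (1 / 2 : ℂ) • ∑ l : Fin 4, ∑ k : Fin 4,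
      (frame (p, r) k * (frame.transpose * (detForm ⊗ₖ detForm)) l (q, s)) •
        fun ρ => (toSO4 ρ (FreeGroup.of m)).1 k l := by
    funext ρ
    have h1 := congrFun (congrFun (kronecker_eq_of_spinMatrix (ρ 0 (FreeGroup.of m)).1
      (ρ 1 (FreeGroup.of m)).1) (p, r)) (q, s)
    rw [Matrix.smul_apply, Matrix.mul_apply] at h1
    simp only [Matrix.mul_apply (M := frame), Finset.sum_mul] at h1
    simp only [Pi.smul_apply, Finset.sum_apply, Pi.mul_apply]
    refine h1.trans ?_
    congr 1
    refine Finset.sum_congr rfl fun l _ => Finset.sum_congr rfl fun k _ => ?_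
    exact mul_right_comm _ _ _
  rw [h]
  exact pulledBack.smul_mem (sum_mem fun l _ => sum_mem fun k _ =>
    pulledBack.smul_mem (hM k l) _) _

theorem entry_det (m j : Fin 2) :
    entry m j 0 0 * entry m j 1 1 - entry m j 0 1 * entry m j 1 0 = 1 := by
  funext ρ
  have := (ρ j (FreeGroup.of m)).2
  rwa [Matrix.det_fin_two] at this

/-- Products of an even number of entries at the same generator are regular on `SO(4, ℂ)`. -/
theorem entry_mul_entry_mem_pulledBack (m j k p q r s : Fin 2) :
    entry m j p q * entry m k r s ∈ pulledBack := by
  fin_cases j <;> fin_cases k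
  · have h : entry m 0 p q * entry m 0 r s =
        (entry m 0 p q * entry m 1 0 0) * (entry m 0 r s * entry m 1 1 1) -
          (entry m 0 p q * entry m 1 0 1) * (entry m 0 r s * entry m 1 1 0) := by
      linear_combination -(entry m 0 p q * entry m 0 r s) * entry_det m 1
    change entry m 0 p q * entry m 0 r s ∈ _
    rw [h]
    exact sub_mem (mul_mem (entry_mul_entry_mem ..) (entry_mul_entry_mem ..))
      (mul_mem (entry_mul_entry_mem ..) (entry_mul_entry_mem ..))
  · exact entry_mul_entry_mem m p q r s
  · change entry m 1 p q * entry m 0 r s ∈ _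
    rw [mul_comm]
    exact entry_mul_entry_mem m r s p q
  · have h : entry m 1 p q * entry m 1 r s =
        (entry m 0 0 0 * entry m 1 p q) * (entry m 0 1 1 * entry m 1 r s) -
          (entry m 0 0 1 * entry m 1 p q) * (entry m 0 1 0 * entry m 1 r s) := by
      linear_combination -(entry m 1 p q * entry m 1 r s) * entry_det m 0
    change entry m 1 p q * entry m 1 r s ∈ _
    rw [h]
    exact sub_mem (mul_mem (entry_mul_entry_mem ..) (entry_mul_entry_mem ..))
      (mul_mem (entry_mul_entry_mem ..) (entry_mul_entry_mem ..))

theorem trGen_eq (i j : Fin 2) : trGen i j = ∑ p, entry i j p p := by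
  funext ρ
  simp [trGen, entry, Matrix.trace]

theorem trProd_eq (j : Fin 2) : trProd j = ∑ r, ∑ s, entry 0 j r s * entry 1 j s r := by
  funext ρ
  simp [trProd, entry, Matrix.trace, Matrix.mul_apply]

/-- Expanded in matrix entries, every term has an even number of entries at each γₘ, and these can
be paired off. -/
theorem value_mem_pulledBack (x : Gen) : (fun ρ => x.value ρ) ∈ pulledBack := by
  cases x with
  | a i jk =>
    induction jk with | _ j k
    change trGen i j * trGen i k ∈ _
    rw [trGen_eq, trGen_eq, Finset.sum_mul_sum]
    exact sum_mem fun p _ => sum_mem fun q _ => entry_mul_entry_mem_pulledBack ..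
  | b jk =>
    induction jk with | _ j k
    change trProd j * trProd k ∈ _
    rw [trProd_eq, trProd_eq]
    simp only [Finset.sum_mul, Finset.mul_sum, mul_mul_mul_comm _ _ (entry 0 _ _ _)]
    exact sum_mem fun _ _ => sum_mem fun _ _ => sum_mem fun _ _ => sum_mem fun _ _ =>
      mul_mem (entry_mul_entry_mem_pulledBack ..) (entry_mul_entry_mem_pulledBack ..)
  | c i j k =>
    change trGen 0 i * trGen 1 j * trProd k ∈ _
    rw [trGen_eq, trGen_eq, trProd_eq]
    simp only [Finset.sum_mul, Finset.mul_sum, mul_mul_mul_comm _ _ (entry 0 _ _ _)]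
    exact sum_mem fun _ _ => sum_mem fun _ _ => sum_mem fun _ _ => sum_mem fun _ _ =>
      mul_mem (entry_mul_entry_mem_pulledBack ..) (entry_mul_entry_mem_pulledBack ..)

/-- Conjugation invariance on SO(4) can be checked after lifting both the representation and the
conjugating element, where it becomes invariance of traces. -/
theorem exists_charRing_eq_value (x : Gen) :
    ∃ f : charRingSO4, ∀ ρ, f.1 (toSO4 ρ) = x.value ρ := by
  obtain ⟨f, hf, hfx⟩ := value_mem_pulledBack x
  have h : ∀ ρ, f (toSO4 ρ) = x.value ρ := fun ρ => congrFun hfx ρ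
  refine ⟨⟨f, hf, fun g ψ => ?_⟩, h⟩
  obtain ⟨ρ, rfl⟩ := toSO4_surjective ψ
  obtain ⟨⟨A, B⟩, rfl⟩ := phi_surjective g
  have h1 := toSO4_conjPair ![A, B] ρ
  simp only [Matrix.cons_val_zero, Matrix.cons_val_one] at h1
  rw [← h1, h, h, value_eq_genVal, value_eq_genVal, traces_conjPair]

theorem eval_value_eq (q : MvPolynomial Gen ℂ) (ρ : SLPair) :
    eval (fun x => x.value ρ) q = eval (traces ρ) (toTraces q) := by
  induction q using MvPolynomial.induction_on with
  | C r => simp [toTraces, algebraMap_eq]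
  | add p q hp hq => simp [hp, hq]
  | mul_X p x hp =>
    rw [map_mul, map_mul, map_mul, hp, eval_X, value_eq_genVal, toTraces, aeval_X, map_genVal]
    congr 2
    ext v
    simp

/-- The presentation of the coordinate ring by the generators. -/
theorem exists_surjective_ker_eq : ∃ Ψ : MvPolynomial Gen ℂ →ₐ[ℂ] charRingSO4,
    Function.Surjective Ψ ∧ RingHom.ker Ψ = relIdeal ∧
      ∀ x ρ, (Ψ (X x)).1 (toSO4 ρ) = x.value ρ := by
  choose f hf using exists_charRing_eq_value
  have hΨ : ∀ q ρ, (aeval f q).1 (toSO4 ρ) = eval (traces ρ) (toTraces q) := fun q ρ => by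
    rw [← eval_value_eq]
    induction q using MvPolynomial.induction_on with
    | C r =>
      rw [eval_C, ← algebraMap_eq, AlgHom.commutes]
      rfl
    | add p q hp hq =>
      rw [map_add, map_add, ← hp, ← hq]
      rfl
    | mul_X p x hp =>
      rw [map_mul, map_mul, ← hp, eval_X, aeval_X, ← hf]
      rfl
  refine ⟨aeval f, fun g => ?_, ?_, fun x ρ => by rw [aeval_X, hf]⟩
  · obtain ⟨q, hq⟩ := exists_toTraces_eq g
    refine ⟨q, Subtype.ext (funext fun ψ => ?_)⟩
    obtain ⟨ρ, rfl⟩ := toSO4_surjective ψ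
    rw [hΨ, hq]
  · ext q
    rw [← ker_toTraces, RingHom.mem_ker, RingHom.mem_ker]
    -- A polynomial vanishing at the traces of all pairs vanishes on all of ℂ⁶, hence is zero.
    refine ⟨fun h => MvPolynomial.funext fun τ => ?_, fun h => Subtype.ext (funext fun ψ => ?_)⟩
    · obtain ⟨ρ, rfl⟩ := traces_surjective τ
      rw [← hΨ, h, map_zero]
      rfl
    · obtain ⟨ρ, rfl⟩ := toSO4_surjective ψ
      rw [hΨ, h, map_zero]
      rfl

end

end SO4CharVar

open SO4CharVar in
/-- There is exactly one isomorphism from the quotient of the polynomial ring in the `17`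
generators by the relations onto `ℂ[X_{SO(4, ℂ)}(F_2)]` which sends each generator to the function
whose pullback along `φ` is the corresponding product of traces on pairs of representations of
`F_2` into `SL(2, ℂ)`. -/
theorem proposition4p9 :
    ∃! e : (MvPolynomial Gen ℂ ⧸ relIdeal) ≃ₐ[ℂ] charRingSO4,
      ∀ (g : Gen) (ρ : Fin 2 → FreeGroup (Fin 2) →* SL(2, ℂ)),
        (e (Ideal.Quotient.mk relIdeal (MvPolynomial.X g))).1 (phi.comp ((ρ 0).prod (ρ 1))) =
          g.value ρ := by
  obtain ⟨Ψ, hsurj, hker, hval⟩ := exists_surjective_ker_eq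
  refine ⟨(Ideal.quotientEquivAlgOfEq ℂ hker.symm).trans
    (Ideal.quotientKerAlgEquivOfSurjective hsurj), fun g ρ => ?_, fun e he => ?_⟩
  · exact hval g ρ
  · have h : (e : (MvPolynomial Gen ℂ ⧸ relIdeal) →ₐ[ℂ] charRingSO4).comp
        (Ideal.Quotient.mkₐ ℂ relIdeal) = Ψ := by
      refine MvPolynomial.algHom_ext fun g => Subtype.ext (funext fun ψ => ?_)
      obtain ⟨ρ, rfl⟩ := toSO4_surjective ψ
      exact (he g ρ).trans (hval g ρ).symm
    refine AlgEquiv.ext fun x => ?_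
    obtain ⟨q, rfl⟩ := Ideal.Quotient.mk_surjective x
    exact (DFunLike.congr_fun h q)
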